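/- Fix $q\ge 1$ (the alphabet size). For probability distributions $f,g$ on a $q$-point set let $\mathcal H^2(f\|g)=\frac12\sum_i(\sqrt{f(i)}-\sqrt{g(i)})^2$. An instance consists of a partition of $[n]$ into $k$ nonempty clusters and of two distributions $f_+,f_-$ on a fixed set of $q$ points. An algorithm is given $n$ and a random matrix $W=(w_{u,v})_{1\le u<v\le n}$ with independent entries, $w_{u,v}\sim f_+$ if $u,v$ lie in the same cluster and $w_{u,v}\sim f_-$ otherwise. It may toss fair coins (independent of $W$) and may adaptively query an oracle, which tells for a pair $u,v$ whether the two elements are in the same cluster. It does not know $k$, $f_+$, $f_-$ or the partition. Write $B=\min\left(nk,\ \frac{k^2\log n}{\mathcal H^2(f_+\|f_-)}\right)$, with $B=nk$ if $f_+=f_-$. (1) (Monte Carlo.) For every $\varepsilon>0$ there are a randomized algorithm, a constant $C$ and a function $\delta(n)=o(1/n)$, depending only on $q$ and $\varepsilon$, such that the algorithm always runs in time polynomial in $n$, and for every instance all of whose clusters have at most $(1-\varepsilon)n$ elements it holds with probability at least $1-\delta(n)$ that the algorithm outputs exactly the true clusters and makes at most $C\,B$ oracle queries. (2) (Las Vegas.)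 There are an algorithm, a constant $C$ and a function $\delta(n)=o(1/n)$, depending only on $q$, such that the algorithm always runs in time polynomial in $n$ and always outputs exactly the true clusters, and for every instance it makes at most $C\,(n\log n+B)$ oracle queries with probability at least $1-\delta(n)$. Running time is the logarithmic cost of a random-access program. -/

import Mathlib

open MeasureTheory

namespace QueryCluster

/-! ### Computational model

Probabilistic oracle programs over a memory of arrays of natural numbers, in a while-language with
logarithmic cost: evaluating a node of an expression costs one plus the bit length of its value, so
that running times agree, up to polynomial factors, with those of Turing machines. -/

/-- Binary operations; subtraction is truncated, division is rounded down, and the comparisons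
return `1` or `0`. -/
inductive Op
  | add | sub | mul | div | lt | eq

def Op.eval : Op → ℕ → ℕ → ℕ
  | .add, x, y => x + y
  | .sub, x, y => x - y
  | .mul, x, y => x * y
  | .div, x, y => x / y
  | .lt, x, y => if x < y then 1 else 0
  | .eq, x, y => if x = y then 1 else 0

/-- `cell a e` is the entry of the array number `a` at the position given by the value of `e`. -/
inductive Expr
  | lit (m : ℕ)
  | cell (a : ℕ) (e : Expr)
  | bin (o : Op) (e₁ e₂ : Expr)

def Expr.val (mem : ℕ → ℕ → ℕ) : Expr → ℕ
  | .lit m => m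
  | .cell a e => mem a (e.val mem)
  | .bin o e₁ e₂ => o.eval (e₁.val mem) (e₂.val mem)

def Expr.cost (mem : ℕ → ℕ → ℕ) : Expr → ℕ
  | .lit m => 1 + m.size
  | .cell a e => 1 + (mem a (e.val mem)).size + e.cost mem
  | .bin o e₁ e₂ => 1 + (o.eval (e₁.val mem) (e₂.val mem)).size + e₁.cost mem + e₂.cost mem

/-- Programs. The destination of `assign`, `query` and `flip` is the entry number `i` of the
array `a`. -/
inductive Prog
  | skip
  | assign (a : ℕ) (i e : Expr)
  | seq (c d : Prog)
  | cond (b : Expr) (c d : Prog)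
  | loop (b : Expr) (c : Prog)
  /-- ask the oracle whether `u` and `v` lie in the same cluster, and store the answer -/
  | query (a : ℕ) (i u v : Expr)
  /-- store a fair random bit -/
  | flip (a : ℕ) (i : Expr)

/-- Memory, elapsed time, number of oracle queries made, number of random bits used. -/
structure State where
  mem : ℕ → ℕ → ℕ
  time : ℕ
  queries : ℕ
  coins : ℕ

def State.tick (s : State) (t : ℕ) : State := { s with time := s.time + t }

def State.write (s : State) (a i x : ℕ) : State :=
  { s with mem := Function.update s.mem a (Function.update (s.mem a) i x) }

/-- `Exec O ω c s t`: with oracle `O` and random tape `ω`, the program `c` started in the state `s`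
halts in the state `t`. -/
inductive Exec (O : ℕ → ℕ → Bool) (ω : ℕ → Bool) : Prog → State → State → Prop
  | skip (s : State) : Exec O ω .skip s (s.tick 1)
  | assign (a : ℕ) (i e : Expr) (s : State) :
      Exec O ω (.assign a i e) s
        ((s.tick (1 + i.cost s.mem + e.cost s.mem)).write a (i.val s.mem) (e.val s.mem))
  | seq {c d : Prog} {s t r : State} (hc : Exec O ω c s t) (hd : Exec O ω d t r) :
      Exec O ω (.seq c d) s r
  | cond_true {b : Expr} {c d : Prog} {s t : State} (hb : b.val s.mem ≠ 0)
      (hc : Exec O ω c (s.tick (1 + b.cost s.mem)) t) : Exec O ω (.cond b c d) s t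
  | cond_false {b : Expr} {c d : Prog} {s t : State} (hb : b.val s.mem = 0)
      (hd : Exec O ω d (s.tick (1 + b.cost s.mem)) t) : Exec O ω (.cond b c d) s t
  | loop_true {b : Expr} {c : Prog} {s t r : State} (hb : b.val s.mem ≠ 0)
      (hc : Exec O ω c (s.tick (1 + b.cost s.mem)) t) (hl : Exec O ω (.loop b c) t r) :
      Exec O ω (.loop b c) s r
  | loop_false {b : Expr} {c : Prog} {s : State} (hb : b.val s.mem = 0) :
      Exec O ω (.loop b c) s (s.tick (1 + b.cost s.mem))
  | query (a : ℕ) (i u v : Expr) (s : State) :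
      Exec O ω (.query a i u v) s
        { (s.tick (1 + i.cost s.mem + u.cost s.mem + v.cost s.mem)).write a (i.val s.mem)
            (O (u.val s.mem) (v.val s.mem)).toNat with queries := s.queries + 1 }
  | flip (a : ℕ) (i : Expr) (s : State) :
      Exec O ω (.flip a i) s
        { (s.tick (1 + i.cost s.mem)).write a (i.val s.mem) (ω s.coins).toNat with
          coins := s.coins + 1 }

/-- A program has at most one final state, so "the run halts in a state with property `P`" may be
expressed by `∃ t, Exec O ω c s t ∧ P t`. -/
theorem Exec.unique {O : ℕ → ℕ → Bool} {ω : ℕ → Bool} {c : Prog} {s t t' : State}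
    (h : Exec O ω c s t) (h' : Exec O ω c s t') : t = t' := by
  induction h generalizing t' with
  | skip s => cases h'; rfl
  | assign a i e s => cases h'; rfl
  | seq _ _ ih₁ ih₂ => cases h' with | seq hc hd => cases ih₁ hc; exact ih₂ hd
  | cond_true hb _ ih =>
    cases h' with
    | cond_true _ hc => exact ih hc
    | cond_false hb' _ => exact absurd hb' hb
  | cond_false hb _ ih =>
    cases h' with
    | cond_true hb' _ => exact absurd hb hb'
    | cond_false _ hc => exact ih hc
  | loop_true hb _ _ ih₁ ih₂ =>
    cases h' with
    | loop_true _ hc hl => cases ih₁ hc; exact ih₂ hl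
    | loop_false hb' => exact absurd hb' hb
  | loop_false hb =>
    cases h' with
    | loop_true hb' _ _ => exact absurd hb hb'
    | loop_false _ => rfl
  | query a i u v s => cases h'; rfl
  | flip a i s => cases h'; rfl

/-! ### The clustering problem

The clusters on the elements `Fin n` are the fibres of a surjective map `c : Fin n → Fin k`. -/

/-- Positions of the upper-triangular similarity matrix. -/
abbrev Pair (n : ℕ) : Type := {p : Fin n × Fin n // p.1 < p.2}

/-- The oracle of a clustering: `true` stands for the answer `+1`, `false` for `-1`. -/
def oracle {n k : ℕ} (c : Fin n → Fin k) (u v : ℕ) : Bool :=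
  if h : u < n ∧ v < n then decide (c ⟨u, h.1⟩ = c ⟨v, h.2⟩) else false

/-- The similarity matrix as an array: the entry `(u, v)`, `u < v`, is at position `u * n + v`. -/
def sideArray {n q : ℕ} (W : Pair n → Fin q) (i : ℕ) : ℕ :=
  if h : i / n < n ∧ i % n < n ∧ i / n < i % n then
    W ⟨(⟨i / n, h.1⟩, ⟨i % n, h.2.1⟩), h.2.2⟩
  else 0

/-- Initially array `0` holds `n` at position `0`, array `1` holds the similarity matrix, and
everything else is zero. -/
def initState {n q : ℕ} (W : Pair n → Fin q) : State where
  mem a i := if a = 0 then (if i = 0 then n else 0) else if a = 1 then sideArray W i else 0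
  time := 0
  queries := 0
  coins := 0

/-- The run of the program `P` on similarity matrix `W`, clustering `c` and random tape `ω` halts
in the state `t`. -/
def HaltsIn {n k q : ℕ} (P : Prog) (c : Fin n → Fin k) (W : Pair n → Fin q) (ω : ℕ → Bool)
    (t : State) : Prop :=
  Exec (oracle c) ω P (initState W) t

/-- The output, a cluster label for each element in array `2`, is the correct clustering. -/
def Recovers {n k : ℕ} (t : State) (c : Fin n → Fin k) : Prop :=
  ∀ u v : Fin n, t.mem 2 u = t.mem 2 v ↔ c u = c v

/-- On inputs with alphabet size `q`, the program halts within a number of steps polynomial in `n`,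
for all similarity matrices, all clusterings and all outcomes of the random bits. -/
def PolyTime (q : ℕ) (P : Prog) : Prop :=
  ∃ p : Polynomial ℕ, ∀ (n k : ℕ) (c : Fin n → Fin k) (W : Pair n → Fin q) (ω : ℕ → Bool),
    ∃ t, HaltsIn P c W ω t ∧ t.time ≤ p.eval n

noncomputable section

/-- Squared Hellinger divergence. -/
def hellingerSq {q : ℕ} (f g : PMF (Fin q)) : ℝ :=
  (1 / 2) * ∑ i, (√(f i).toReal - √(g i).toReal) ^ 2

/-- Law of the similarity matrix: independent entries, distributed as `fp` within clusters and as
`fm` between different clusters. -/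
def sideLaw {n k q : ℕ} (c : Fin n → Fin k) (fp fm : PMF (Fin q)) : Measure (Pair n → Fin q) :=
  Measure.pi fun p : Pair n => (if c p.1.1 = c p.1.2 then fp else fm).toMeasure

/-- Law of a sequence of independent fair bits. -/
def coinLaw : Measure (ℕ → Bool) :=
  Measure.infinitePi fun _ : ℕ => (PMF.uniformOfFintype Bool).toMeasure

/-- Joint law of the similarity matrix and the (independent) random bits of the program. -/
def jointLaw {n k q : ℕ} (c : Fin n → Fin k) (fp fm : PMF (Fin q)) :
    Measure ((Pair n → Fin q) × (ℕ → Bool)) :=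
  (sideLaw c fp fm).prod coinLaw

/-- `min (n k, k² log n / h)`, where the second term is infinite for `h = 0`. -/
def queryBound (n k : ℕ) (h : ℝ) : ℝ :=
  if h = 0 then n * k else min ((n : ℝ) * k) ((k : ℝ) ^ 2 * Real.log n / h)

end

end QueryCluster

/-! Elements are taken in increasing order, and an unlabelled element `u` is queried against one
representative per known cluster, at most `k` queries. The side information then decides whether the
rest of the cluster of `u` can be recognised. For a symbol `x` and an element `v`, count the
processed members `a` of the cluster of `u`, without its representative, whose similarity to `v` is
`x`. If `v` is not among the counted elements, this count is binomial with parameter `f₊(x)` or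
`f₋(x)`, according to whether `v` belongs to the cluster. Square roots of such counts fluctuate by
`O(√log n)` whatever their mean, whereas the centres for the two laws differ by `√s |√f₊(x) -
√f₋(x)|`, where `s` is the number of counted elements. Some symbol has `(√f₊(x) - √f₋(x))² ≥ 2 H² /
q`, so about `q log n / H²` processed members suffice to separate the cluster from everything else.

Since `f₊` and `f₋` are unknown, counts are compared with that of the representative, a certain
member. If some element deviates from it by many fluctuation widths, then that element lies outside,
all outside elements deviate almost as much, and a lower threshold classifies every unlabelled
element correctly (`separates_of_concentrated`). This needs an outside element, which is why a
single cluster is excluded in the Monte Carlo part.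

The adaptivity of the procedure does no harm: the counted set is determined by the clustering, `u`
and the representative (`Consistent.symCount_eq`), so a union bound over fixed sets suffices
(`measure_not_concentrated`, based on `measure_abs_sqrt_indexCount_sub`).

On the good event only elements with at most `M = O(q log n / H²)` predecessors in their cluster are
searched for. There are at most `min(n, k (M + 1))` of them (`earlyCount_le`), each costing at most
`k` queries (`run_stages_of_separates`). The Las Vegas variant confirms every absorbed element by a
query: it is then always correct (`consistent_of_confirm`), and on the good event each confirmation
labels a new element, so at most `n` queries are added. Both programs are deterministic and use only
loops of length `n`, which gives polynomial time (`Cmd.exists_exec`). -/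

namespace QueryCluster

/-! ### Commands with bounded loops -/

/-- Commands in which every loop runs through the numbers below the input size `n`. -/
inductive Cmd
  | assign (a : ℕ) (i e : Expr)
  | seq (c d : Cmd)
  /-- run `c` if the value of `b` is not zero -/
  | guard (b : Expr) (c : Cmd)
  | query (a : ℕ) (i u v : Expr)
  /-- run `c` with entry `0` of the array `x` ranging over the numbers below `n` -/
  | forall_lt (x : ℕ) (c : Cmd)

/-- The variable stored in entry `0` of the array `a`. -/
abbrev reg (a : ℕ) : Expr := .cell a (.lit 0)

def Cmd.toProg : Cmd → Prog
  | .assign a i e => .assign a i e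
  | .seq c d => .seq c.toProg d.toProg
  | .guard b c => .cond b c.toProg .skip
  | .query a i u v => .query a i u v
  | .forall_lt x c =>
    .seq (.assign x (.lit 0) (.lit 0))
      (.loop (.bin .lt (reg x) (reg 0))
        (.seq c.toProg (.assign x (.lit 0) (.bin .add (reg x) (.lit 1)))))

abbrev Mem : Type := ℕ → ℕ → ℕ

def upd (m : Mem) (a i x : ℕ) : Mem := Function.update m a (Function.update (m a) i x)

theorem upd_apply (m : Mem) (a i x b j : ℕ) :
    upd m a i x b j = if b = a ∧ j = i then x else m b j := by
  unfold upd
  by_cases hb : b = a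
  · subst hb
    by_cases hj : j = i <;> simp [hj]
  · simp [hb]

theorem upd_of_ne (m : Mem) {a b : ℕ} (i x : ℕ) (h : b ≠ a) : upd m a i x b = m b := by
  simp [upd, h]

/-- Effect of a command on the memory and the number of queries. -/
def Cmd.run (O : ℕ → ℕ → Bool) : Cmd → Mem × ℕ → Mem × ℕ
  | .assign a i e, s => (upd s.1 a (i.val s.1) (e.val s.1), s.2)
  | .seq c d, s => d.run O (c.run O s)
  | .guard b c, s => if b.val s.1 = 0 then s else c.run O s
  | .query a i u v, s => (upd s.1 a (i.val s.1) (O (u.val s.1) (v.val s.1)).toNat, s.2 + 1)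
  | .forall_lt x c, s =>
    (fun t => (upd (c.run O t).1 x 0 ((c.run O t).1 x 0 + 1), (c.run O t).2))^[s.1 0 0]
      (upd s.1 x 0 0, s.2)

/-- The command may write to the array `a`. -/
def Cmd.Writes : Cmd → ℕ → Prop
  | .assign a _ _, b => b = a
  | .seq c d, b => c.Writes b ∨ d.Writes b
  | .guard _ c, b => c.Writes b
  | .query a _ _ _, b => b = a
  | .forall_lt x c, b => b = x ∨ c.Writes b

/-- Expressions whose value is, up to a constant factor, bounded by the largest memory entry. -/
def Expr.Additive : Expr → Prop
  | .lit _ => True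
  | .cell _ _ => True
  | .bin .mul _ _ => False
  | .bin _ e₁ e₂ => e₁.Additive ∧ e₂.Additive

/-- The input size and the loop variables are not overwritten, and only values of additive
expressions are stored. -/
def Cmd.Ok : Cmd → Prop
  | .assign a _ e => a ≠ 0 ∧ e.Additive
  | .seq c d => c.Ok ∧ d.Ok
  | .guard _ c => c.Ok
  | .query a _ _ _ => a ≠ 0
  | .forall_lt x c => x ≠ 0 ∧ c.Ok ∧ ¬ c.Writes x

theorem Cmd.Ok.not_writes_zero {c : Cmd} (h : c.Ok) : ¬ c.Writes 0 := by
  induction c with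
  | assign a i e => exact fun h' => h.1 h'.symm
  | seq c d hc hd => exact fun h' => h'.elim (hc h.1) (hd h.2)
  | guard b c hc => exact hc h
  | query a i u v => exact fun h' => h h'.symm
  | forall_lt x c hc => exact fun h' => h'.elim (fun h' => h.1 h'.symm) (hc h.2.1)

theorem Cmd.run_of_not_writes (O : ℕ → ℕ → Bool) {c : Cmd} {a : ℕ} (h : ¬ c.Writes a)
    (s : Mem × ℕ) : (c.run O s).1 a = s.1 a := by
  induction c generalizing s with
  | assign b i e => exact upd_of_ne _ _ _ h
  | seq c d hc hd =>
    simp only [Cmd.Writes, not_or] at h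
    simp only [Cmd.run]
    rw [hd h.2, hc h.1]
  | guard b c hc =>
    simp only [Cmd.run]
    split_ifs
    · rfl
    · exact hc h s
  | query b i u v => exact upd_of_ne _ _ _ h
  | forall_lt x c hc =>
    simp only [Cmd.Writes, not_or] at h
    simp only [Cmd.run]
    generalize s.1 0 0 = j
    have : (upd s.1 x 0 0, s.2).1 a = s.1 a := upd_of_ne _ _ _ h.1
    rw [← this]
    generalize (upd s.1 x 0 0, s.2) = t
    induction j generalizing t with
    | zero => rfl
    | succ j ih =>
      rw [Function.iterate_succ_apply, ih]
      exact (upd_of_ne _ _ _ h.1).trans (hc h.2 t)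

/-- Invariant rule for loops. -/
theorem Cmd.run_forall_lt (O : ℕ → ℕ → Bool) {x : ℕ} {c : Cmd} (hok : (Cmd.forall_lt x c).Ok)
    {s : Mem × ℕ} {n : ℕ} (hn : s.1 0 0 = n) (I : ℕ → Mem × ℕ → Prop)
    (hI : ∀ i t y, I i t → I i (upd t.1 x 0 y, t.2)) (h0 : I 0 s)
    (hstep : ∀ i < n, ∀ t : Mem × ℕ, t.1 x 0 = i →
      (∀ a, ¬ (Cmd.forall_lt x c).Writes a → t.1 a = s.1 a) → I i t → I (i + 1) (c.run O t)) :
    I n ((Cmd.forall_lt x c).run O s) := by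
  simp only [Cmd.run, hn]
  suffices H : ∀ j i, i + j = n → ∀ t : Mem × ℕ, t.1 x 0 = i →
      (∀ a, ¬ (Cmd.forall_lt x c).Writes a → t.1 a = s.1 a) → I i t →
      I n ((fun t => (upd (c.run O t).1 x 0 ((c.run O t).1 x 0 + 1), (c.run O t).2))^[j] t) by
    refine H n 0 (zero_add n) _ (by simp [upd_apply]) (fun a ha => ?_) (hI _ _ _ h0)
    exact upd_of_ne _ _ _ fun h => ha (Or.inl h)
  intro j
  induction j with
  | zero => rintro i rfl t - - h; exact h
  | succ j ih =>
    intro i hij t htx htf hi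
    rw [Function.iterate_succ_apply]
    refine ih (i + 1) (by omega) _ ?_ (fun a ha => ?_) (hI _ _ _ (hstep i (by omega) t htx htf hi))
    · simp [upd_apply, Cmd.run_of_not_writes O hok.2.2, htx]
    · exact (upd_of_ne _ _ _ fun h => ha (Or.inl h)).trans
        ((Cmd.run_of_not_writes O (fun h => ha (Or.inr h)) t).trans (htf a ha))

/-! ### Running time of commands -/

/-- All memory entries have at most `b` bits. -/
def Bits (m : Mem) (b : ℕ) : Prop := ∀ a i, (m a i).size ≤ b

theorem Bits.mono {m : Mem} {b b' : ℕ} (h : Bits m b) (hb : b ≤ b') : Bits m b' :=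
  fun a i => (h a i).trans hb

theorem Bits.upd {m : Mem} {b x : ℕ} (h : Bits m b) (hx : x.size ≤ b) (a i : ℕ) :
    Bits (upd m a i x) b := by
  intro a' i'
  rw [upd_apply]
  split_ifs
  · exact hx
  · exact h a' i'

theorem size_add_le (x y : ℕ) : (x + y).size ≤ max x.size y.size + 1 := by
  rw [Nat.size_le, pow_succ]
  have h₁ := Nat.size_le.1 (le_max_left x.size y.size)
  have h₂ := Nat.size_le.1 (le_max_right x.size y.size)
  omega

theorem size_mul_le (x y : ℕ) : (x * y).size ≤ x.size + y.size := by
  rw [Nat.size_le, pow_add]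
  exact Nat.mul_lt_mul'' (Nat.lt_size_self x) (Nat.lt_size_self y)

theorem size_toNat_le (b : Bool) : b.toNat.size ≤ 1 := by cases b <;> simp

theorem size_ite_le (p : Prop) [Decidable p] : (if p then 1 else 0 : ℕ).size ≤ 1 := by
  split_ifs <;> simp

theorem size_eval_le (o : Op) (x y : ℕ) : (o.eval x y).size ≤ x.size + y.size + 1 := by
  cases o <;> simp only [Op.eval]
  · have := size_add_le x y; omega
  · have := Nat.size_le_size (Nat.sub_le x y); omega
  · have := size_mul_le x y; omega
  · have := Nat.size_le_size (Nat.div_le_self x y); omega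
  · have := size_ite_le (x < y); omega
  · have := size_ite_le (x = y); omega

theorem Expr.exists_cost_le (e : Expr) : ∃ K, ∀ m b, Bits m b →
    (e.val m).size ≤ K * (b + 1) ∧ e.cost m ≤ K * (b + 1) := by
  induction e with
  | lit l =>
    refine ⟨1 + l.size, fun m b _ => ?_⟩
    simp only [Expr.val, Expr.cost]
    constructor <;> nlinarith [Nat.zero_le (l.size * b)]
  | cell a e ih =>
    obtain ⟨K, hK⟩ := ih
    refine ⟨K + 1, fun m b hb => ?_⟩
    have h := hb a (e.val m)
    have h' := (hK m b hb).2
    simp only [Expr.val, Expr.cost]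
    constructor <;> nlinarith
  | bin o e₁ e₂ ih₁ ih₂ =>
    obtain ⟨K₁, h₁⟩ := ih₁
    obtain ⟨K₂, h₂⟩ := ih₂
    refine ⟨2 * K₁ + 2 * K₂ + 2, fun m b hb => ?_⟩
    have h := size_eval_le o (e₁.val m) (e₂.val m)
    have h₁' := h₁ m b hb
    have h₂' := h₂ m b hb
    simp only [Expr.val, Expr.cost]
    constructor <;> nlinarith

/-- The growth is by an additive constant, unlike the factor in `Expr.exists_cost_le`. Only additive
growth stays polynomial when an assignment is repeated in nested loops; repeated squaring would not.
-/
theorem Expr.Additive.exists_size_le {e : Expr} (he : e.Additive) :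
    ∃ K, ∀ m b, Bits m b → (e.val m).size ≤ b + K := by
  induction e with
  | lit l => exact ⟨l.size, fun m b _ => Nat.le_add_left _ _⟩
  | cell a e _ => exact ⟨0, fun m b hb => hb _ _⟩
  | bin o e₁ e₂ ih₁ ih₂ =>
    cases o with
    | mul => exact he.elim
    | lt => exact ⟨1, fun m b _ => (size_ite_le _).trans (by omega)⟩
    | eq => exact ⟨1, fun m b _ => (size_ite_le _).trans (by omega)⟩
    | add =>
      obtain ⟨K₁, h₁⟩ := ih₁ he.1
      obtain ⟨K₂, h₂⟩ := ih₂ he.2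
      refine ⟨K₁ + K₂ + 1, fun m b hb => (size_add_le _ _).trans ?_⟩
      have := h₁ m b hb
      have := h₂ m b hb
      omega
    | sub =>
      obtain ⟨K₁, h₁⟩ := ih₁ he.1
      exact ⟨K₁, fun m b hb => (Nat.size_le_size (Nat.sub_le _ _)).trans (h₁ m b hb)⟩
    | div =>
      obtain ⟨K₁, h₁⟩ := ih₁ he.1
      exact ⟨K₁, fun m b hb => (Nat.size_le_size (Nat.div_le_self _ _)).trans (h₁ m b hb)⟩

theorem eval_mono (p : Polynomial ℕ) {x y : ℕ} (h : x ≤ y) : p.eval x ≤ p.eval y := by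
  simp only [Polynomial.eval_eq_sum]
  exact Finset.sum_le_sum fun i _ => Nat.mul_le_mul_left _ (Nat.pow_le_pow_left h i)

/-- The bit growth `G` of the body depends on `n` alone and not on the current bit bound `b`, so `j`
rounds add at most `j * (G n + 2)` bits, and every round is charged at the final bit bound. The `2`
pays for incrementing the counter, also when the bit bound is still zero. -/
theorem exec_loop {O : ℕ → ℕ → Bool} {ω : ℕ → Bool} {x : ℕ} {c : Cmd}
    (hok : (Cmd.forall_lt x c).Ok) {G T : Polynomial ℕ}
    (hc : ∀ s b, Bits s.mem b → ∃ t, Exec O ω c.toProg s t ∧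
      (t.mem, t.queries) = c.run O (s.mem, s.queries) ∧ Bits t.mem (b + G.eval (s.mem 0 0)) ∧
      t.time ≤ s.time + T.eval (s.mem 0 0 + b))
    {K : ℕ} (hKb : ∀ m b, Bits m b → (Expr.bin .lt (reg x) (reg 0)).cost m ≤ K * (b + 1))
    (hKi : ∀ m b, Bits m b → (Expr.bin .add (reg x) (.lit 1)).cost m ≤ K * (b + 1))
    (n j i : ℕ) (hij : i + j = n) (s : State) (hn : s.mem 0 0 = n) (hi : s.mem x 0 = i)
    (b : ℕ) (hb : Bits s.mem b) :
    ∃ t, Exec O ω (.loop (.bin .lt (reg x) (reg 0))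
        (.seq c.toProg (.assign x (.lit 0) (.bin .add (reg x) (.lit 1))))) s t ∧
      (t.mem, t.queries) =
        (fun t => (upd (c.run O t).1 x 0 ((c.run O t).1 x 0 + 1), (c.run O t).2))^[j]
          (s.mem, s.queries) ∧
      Bits t.mem (b + j * (G.eval n + 2)) ∧
      t.time ≤ s.time + (j + 1) * (T.eval (n + (b + j * (G.eval n + 2))) +
        (2 * K + 4) * (b + j * (G.eval n + 2) + 1)) := by
  induction j generalizing i s b with
  | zero =>
    refine ⟨_, .loop_false ?_, rfl, by simpa [State.tick] using hb, ?_⟩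
    · simp [Expr.val, Op.eval, hi, hn, ← hij]
    · have := hKb _ _ hb
      simp only [State.tick]
      nlinarith
  | succ j ih =>
    have hb₁ := hKb _ _ hb
    obtain ⟨t, hct, hrun, htb, htt⟩ :=
      hc (s.tick (1 + (Expr.bin .lt (reg x) (reg 0)).cost s.mem)) b hb
    simp only [State.tick] at hrun htb htt
    have hmem : t.mem = (c.run O (s.mem, s.queries)).1 := congrArg Prod.fst hrun
    have hq : t.queries = (c.run O (s.mem, s.queries)).2 := congrArg Prod.snd hrun
    have htx : t.mem x 0 = i := by rw [hmem, Cmd.run_of_not_writes O hok.2.2]; exact hi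
    have ht0 : t.mem 0 0 = n := by
      rw [hmem, Cmd.run_of_not_writes O hok.2.1.not_writes_zero]
      exact hn
    rw [hn] at htb htt
    have hcost := hKi _ _ htb
    obtain ⟨r, hr, hrr, hrb, hrt⟩ := ih (i + 1) (by omega)
      ((t.tick (1 + (Expr.lit 0).cost t.mem +
        (Expr.bin .add (reg x) (.lit 1)).cost t.mem)).write x ((Expr.lit 0).val t.mem)
        ((Expr.bin .add (reg x) (.lit 1)).val t.mem))
      (by
        change upd t.mem x 0 _ 0 0 = n
        rw [upd_of_ne _ _ _ hok.1.symm, ht0])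
      (by
        change upd t.mem x 0 (t.mem x 0 + 1) x 0 = i + 1
        simp [upd_apply, htx])
      (b + (G.eval n + 2))
      (by
        refine Bits.upd (htb.mono (by omega)) ?_ x 0
        refine (size_add_le _ _).trans ?_
        have := htb x 0
        simp only [Expr.val, Nat.size_one]
        omega)
    refine ⟨r, .loop_true ?_ (.seq hct (.assign _ _ _ _)) hr, ?_, ?_, ?_⟩
    · simp [Expr.val, Op.eval, hi, hn]
      omega
    · rw [hrr, Function.iterate_succ_apply]
      change _^[j] (upd t.mem x 0 (t.mem x 0 + 1), t.queries) = _
      rw [hmem, hq]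
    · exact hrb.mono (by ring_nf; omega)
    · have e : b + (G.eval n + 2) + j * (G.eval n + 2) = b + (j + 1) * (G.eval n + 2) := by ring
      rw [e] at hrt
      set B := b + (j + 1) * (G.eval n + 2) with hB
      have hBb : b + (G.eval n + 2) ≤ B := by rw [← e]; exact Nat.le_add_right _ _
      have hT : T.eval (n + b) ≤ T.eval (n + B) := eval_mono T (by omega)
      simp only [State.tick, State.write, Expr.cost, Nat.size_zero] at hrt hcost htt hb₁
      have hK₁ : K * (b + 1) ≤ K * (B + 1) := Nat.mul_le_mul_left _ (by omega)
      have hK₂ : K * (b + G.eval n + 1) ≤ K * (B + 1) := Nat.mul_le_mul_left _ (by omega)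
      have : (2 * K + 4) * (B + 1) = 2 * (K * (B + 1)) + 4 * B + 4 := by ring
      have : (j + 1 + 1) * (T.eval (n + B) + (2 * K + 4) * (B + 1)) =
        (j + 1) * (T.eval (n + B) + (2 * K + 4) * (B + 1)) +
          (T.eval (n + B) + (2 * K + 4) * (B + 1)) := by ring
      omega

/-- Commands halt, with the effect described by `Cmd.run`, in polynomial time. -/
theorem Cmd.exists_exec {c : Cmd} (hok : c.Ok) : ∃ G T : Polynomial ℕ, ∀ O ω s b, Bits s.mem b →
    ∃ t, Exec O ω c.toProg s t ∧ (t.mem, t.queries) = c.run O (s.mem, s.queries) ∧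
      Bits t.mem (b + G.eval (s.mem 0 0)) ∧ t.time ≤ s.time + T.eval (s.mem 0 0 + b) := by
  open Polynomial in
  induction c with
  | assign a i e =>
    obtain ⟨K, hK⟩ := hok.2.exists_size_le
    obtain ⟨K₁, hK₁⟩ := i.exists_cost_le
    obtain ⟨K₂, hK₂⟩ := e.exists_cost_le
    refine ⟨C K, C (K₁ + K₂ + 1) * (X + 1), fun O ω s b hb => ⟨_, .assign a i e s, rfl, ?_, ?_⟩⟩
    · rw [eval_C]
      exact Bits.upd (hb.mono (Nat.le_add_right _ _)) (hK _ _ hb) _ _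
    · have h₁ := (hK₁ _ _ hb).2
      have h₂ := (hK₂ _ _ hb).2
      simp only [State.tick, State.write, eval_mul, eval_C, eval_add, eval_X, eval_one]
      nlinarith [Nat.zero_le ((K₁ + K₂) * s.mem 0 0)]
  | query a i u v =>
    obtain ⟨K₁, hK₁⟩ := i.exists_cost_le
    obtain ⟨K₂, hK₂⟩ := u.exists_cost_le
    obtain ⟨K₃, hK₃⟩ := v.exists_cost_le
    refine ⟨C 1, C (K₁ + K₂ + K₃ + 1) * (X + 1),
      fun O ω s b hb => ⟨_, .query a i u v s, rfl, ?_, ?_⟩⟩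
    · rw [eval_C]
      exact Bits.upd (hb.mono (Nat.le_add_right _ _)) ((size_toNat_le _).trans (by omega)) _ _
    · have h₁ := (hK₁ _ _ hb).2
      have h₂ := (hK₂ _ _ hb).2
      have h₃ := (hK₃ _ _ hb).2
      simp only [State.tick, State.write, eval_mul, eval_C, eval_add, eval_X, eval_one]
      nlinarith [Nat.zero_le ((K₁ + K₂ + K₃) * s.mem 0 0)]
  | seq c d hc hd =>
    obtain ⟨G₁, T₁, h₁⟩ := hc hok.1
    obtain ⟨G₂, T₂, h₂⟩ := hd hok.2
    -- The second command starts with up to `b + G₁ n` bits, hence the composition.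
    refine ⟨G₁ + G₂, T₁ + T₂.comp (X + G₁), fun O ω s b hb => ?_⟩
    obtain ⟨t, ht, htr, htb, htt⟩ := h₁ O ω s b hb
    obtain ⟨r, hr, hrr, hrb, hrt⟩ := h₂ O ω t _ htb
    have h0 : t.mem 0 0 = s.mem 0 0 := by
      rw [show t.mem = _ from congrArg Prod.fst htr,
        Cmd.run_of_not_writes O hok.1.not_writes_zero]
    rw [h0] at hrb hrt
    refine ⟨r, .seq ht hr, by rw [hrr, htr]; rfl, hrb.mono (by rw [eval_add]; omega), ?_⟩
    have : T₂.eval (s.mem 0 0 + (b + G₁.eval (s.mem 0 0))) ≤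
        T₂.eval (s.mem 0 0 + b + G₁.eval (s.mem 0 0 + b)) :=
      eval_mono _ (by have := eval_mono G₁ (Nat.le_add_right (s.mem 0 0) b); omega)
    rw [eval_add, eval_comp, eval_add, eval_X]
    omega
  | guard e c hc =>
    obtain ⟨G, T, h⟩ := hc hok
    obtain ⟨K, hK⟩ := e.exists_cost_le
    refine ⟨G, T + C (K + 2) * (X + 1), fun O ω s b hb => ?_⟩
    have he := (hK _ _ hb).2
    by_cases h0 : e.val s.mem = 0
    · refine ⟨_, .cond_false h0 (.skip _), ?_, hb.mono (Nat.le_add_right _ _), ?_⟩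
      · simp [Cmd.run, h0, State.tick]
      · simp only [State.tick, eval_mul, eval_C, eval_add, eval_X, eval_one]
        nlinarith [Nat.zero_le (K * s.mem 0 0)]
    · obtain ⟨t, ht, htr, htb, htt⟩ := h O ω (s.tick (1 + e.cost s.mem)) b hb
      refine ⟨t, .cond_true h0 ht, ?_, htb, ?_⟩
      · simpa [Cmd.run, h0, State.tick] using htr
      · simp only [State.tick, eval_mul, eval_C, eval_add, eval_X, eval_one] at htt ⊢
        nlinarith [Nat.zero_le (K * s.mem 0 0)]
  | forall_lt x c hc =>
    obtain ⟨G, T, h⟩ := hc hok.2.1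
    obtain ⟨K₁, hK₁⟩ := (Expr.bin .lt (reg x) (reg 0)).exists_cost_le
    obtain ⟨K₂, hK₂⟩ := (Expr.bin .add (reg x) (.lit 1)).exists_cost_le
    refine ⟨X * (G + C 2), C 3 + (X + 1) * (T.comp (X + X * (G + C 2)) +
      C (2 * (K₁ + K₂) + 4) * (X + X * (G + C 2) + 1)), fun O ω s b hb => ?_⟩
    obtain ⟨t, ht, htr, htb, htt⟩ := exec_loop hok (h O ω) (K := K₁ + K₂)
      (fun m b hb => (hK₁ m b hb).2.trans (Nat.mul_le_mul_right _ (Nat.le_add_right _ _)))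
      (fun m b hb => (hK₂ m b hb).2.trans (Nat.mul_le_mul_right _ (Nat.le_add_left _ _)))
      (s.mem 0 0) (s.mem 0 0) 0 (zero_add _)
      ((s.tick (1 + (Expr.lit 0).cost s.mem + (Expr.lit 0).cost s.mem)).write x 0 0)
      (by
        change upd s.mem x 0 _ 0 0 = _
        rw [upd_of_ne _ _ _ hok.1.symm])
      (by
        change upd s.mem x 0 0 x 0 = 0
        simp [upd_apply])
      b (hb.upd (by simp) x 0)
    refine ⟨t, .seq (.assign _ _ _ _) ht, htr, ?_, ?_⟩
    · simpa using htb
    · set n := s.mem 0 0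
      simp only [State.tick, State.write, Expr.cost, Nat.size_zero] at htt
      simp only [eval_mul, eval_C, eval_add, eval_X, eval_one, eval_comp]
      have hG := eval_mono G (Nat.le_add_right n b)
      have hle : n * (G.eval n + 2) ≤ (n + b) * (G.eval (n + b) + 2) :=
        Nat.mul_le_mul (Nat.le_add_right _ _) (by omega)
      refine htt.trans ?_
      have h₁ : T.eval (n + (b + n * (G.eval n + 2))) ≤
        T.eval (n + b + (n + b) * (G.eval (n + b) + 2)) := eval_mono _ (by omega)
      have h₂ : (n + 1) * (T.eval (n + (b + n * (G.eval n + 2))) +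
          (2 * (K₁ + K₂) + 4) * (b + n * (G.eval n + 2) + 1)) ≤ (n + b + 1) *
          (T.eval (n + b + (n + b) * (G.eval (n + b) + 2)) +
            (2 * (K₁ + K₂) + 4) * (n + b + (n + b) * (G.eval (n + b) + 2) + 1)) :=
        Nat.mul_le_mul (by omega) (Nat.add_le_add h₁ (Nat.mul_le_mul_left _ (by omega)))
      omega

theorem bits_initState {n q : ℕ} (W : Pair n → Fin q) : Bits (initState W).mem (n + q) := by
  intro a i
  rw [Nat.size_le]
  refine lt_of_le_of_lt ?_ Nat.lt_two_pow_self
  simp only [initState, sideArray]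
  split_ifs
  · omega
  · omega
  · exact (Fin.is_lt _).le.trans (Nat.le_add_left _ _)
  · omega
  · omega

theorem Cmd.polyTime {c : Cmd} (hok : c.Ok) (q : ℕ) : PolyTime q c.toProg := by
  obtain ⟨G, T, h⟩ := Cmd.exists_exec hok
  refine ⟨T.comp (2 * Polynomial.X + Polynomial.C q), fun n k c W ω => ?_⟩
  obtain ⟨t, ht, -, -, htt⟩ := h (oracle c) ω (initState W) _ (bits_initState W)
  refine ⟨t, ht, htt.trans (le_of_eq ?_)⟩
  have : n + (n + q) = 2 * n + q := by ring
  simp [initState, Polynomial.eval_comp, this]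

theorem Cmd.haltsIn {cmd : Cmd} (hok : cmd.Ok) {n k q : ℕ} (c : Fin n → Fin k)
    (W : Pair n → Fin q) (ω : ℕ → Bool) :
    ∃ t, HaltsIn cmd.toProg c W ω t ∧
      (t.mem, t.queries) = cmd.run (oracle c) ((initState W).mem, 0) := by
  obtain ⟨G, T, h⟩ := Cmd.exists_exec hok
  obtain ⟨t, ht, htr, -, -⟩ := h (oracle c) ω (initState W) _ (bits_initState W)
  exact ⟨t, ht, htr⟩

/-! ### The clustering program

Elements are processed in increasing order. Array `2` holds the labels: `0` for an element that is
not yet classified, and otherwise one plus the representative of its cluster, which is the first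
processed element of the cluster. -/

def Expr.and (e f : Expr) : Expr := .bin .mul e f

def Expr.not (e : Expr) : Expr := .bin .eq e (.lit 0)

/-- The expression has a nonzero value. -/
def Expr.Holds (m : Mem) (e : Expr) : Prop := e.val m ≠ 0

instance (m : Mem) (e : Expr) : Decidable (e.Holds m) := inferInstanceAs (Decidable (_ ≠ _))

theorem Expr.holds_and (m : Mem) (e f : Expr) :
    (Expr.and e f).Holds m ↔ e.Holds m ∧ f.Holds m := by
  simp [Expr.and, Expr.Holds, Expr.val, Op.eval]

theorem Expr.holds_not (m : Mem) (e : Expr) : (Expr.not e).Holds m ↔ ¬ e.Holds m := by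
  by_cases h : e.val m = 0 <;> simp [Expr.not, Expr.Holds, Expr.val, Op.eval, h]

theorem Expr.holds_eq (m : Mem) (e f : Expr) :
    (Expr.bin .eq e f).Holds m ↔ e.val m = f.val m := by
  simp [Expr.Holds, Expr.val, Op.eval]

theorem Expr.holds_lt (m : Mem) (e f : Expr) :
    (Expr.bin .lt e f).Holds m ↔ e.val m < f.val m := by
  simp [Expr.Holds, Expr.val, Op.eval]

theorem Cmd.run_guard (O : ℕ → ℕ → Bool) (b : Expr) (c : Cmd) (s : Mem × ℕ) :
    (Cmd.guard b c).run O s = if b.Holds s.1 then c.run O s else s := by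
  simp only [Cmd.run, Expr.Holds]
  split_ifs <;> simp_all

/-- Position of the entry of the similarity matrix for the elements `v` and `a`. -/
def pos (n v a : ℕ) : ℕ := (v - (v - a)) * n + (v + (a - v))

def posExpr (v a : Expr) : Expr :=
  .bin .add (.bin .mul (.bin .sub v (.bin .sub v a)) (reg 0)) (.bin .add v (.bin .sub a v))

theorem val_posExpr (m : Mem) (v a : Expr) :
    (posExpr v a).val m = pos (m 0 0) (v.val m) (a.val m) := rfl

/-- The counts `a` and `b` differ by more than the random fluctuations, at scale `T * L`. -/
def Far (T L a b : ℕ) : Prop := T * L * (a + b) < (a - b + (b - a)) * (a - b + (b - a))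

def farExpr (T : ℕ) (a b : Expr) : Expr :=
  .bin .lt (.bin .mul (.bin .mul (.lit T) (reg 11)) (.bin .add a b))
    (.bin .mul (.bin .add (.bin .sub a b) (.bin .sub b a))
      (.bin .add (.bin .sub a b) (.bin .sub b a)))

theorem holds_farExpr (m : Mem) (T : ℕ) (a b : Expr) :
    (farExpr T a b).Holds m ↔ Far T (m 11 0) (a.val m) (b.val m) := by
  rw [farExpr, Expr.holds_lt]
  rfl

/-- Compute the bit length of `n` in array `11`. -/
def logCmd : Cmd :=
  .seq (.assign 12 (.lit 0) (.lit 1))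
    (.forall_lt 13 (.guard (.bin .lt (reg 12) (.bin .add (reg 0) (.lit 1)))
      (.seq (.assign 12 (.lit 0) (.bin .add (reg 12) (reg 12)))
        (.assign 11 (.lit 0) (.bin .add (reg 11) (.lit 1))))))

/-- Query the element `u` (array `3`) against all representatives. -/
def searchCmd : Cmd :=
  .forall_lt 4 (.guard (.and (.not (.cell 2 (reg 3)))
      (.bin .eq (.cell 2 (reg 4)) (.bin .add (reg 4) (.lit 1))))
    (.seq (.query 5 (.lit 0) (reg 3) (reg 4))
      (.guard (reg 5) (.assign 2 (reg 3) (.bin .add (reg 4) (.lit 1))))))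

/-- Label the element `u`. -/
def classifyCmd : Cmd :=
  .seq searchCmd
    (.guard (.not (.cell 2 (reg 3))) (.assign 2 (reg 3) (.bin .add (reg 3) (.lit 1))))

/-- The elements processed so far in the cluster of `u`, without the representative, whose
similarity to `v` is the current symbol (array `6`). -/
def countGuard : Expr :=
  .and (.bin .lt (reg 8) (.bin .add (reg 3) (.lit 1)))
    (.and (.bin .eq (.cell 2 (reg 8)) (.cell 2 (reg 3)))
      (.and (.not (.bin .eq (.bin .add (reg 8) (.lit 1)) (.cell 2 (reg 3))))
        (.bin .eq (.cell 1 (posExpr (reg 7) (reg 8))) (reg 6))))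

def tallyCmd : Cmd :=
  .forall_lt 8 (.guard countGuard
    (.assign 9 (reg 7) (.bin .add (.cell 9 (reg 7)) (.lit 1))))

/-- Compute the counts of the current symbol for all elements, in array `9`. -/
def countCmd : Cmd :=
  .forall_lt 7 (.seq (.assign 9 (reg 7) (.lit 0)) tallyCmd)

/-- The count of the representative of the cluster of `u`. -/
def refCount : Expr := .cell 9 (.bin .sub (.cell 2 (reg 3)) (.lit 1))

/-- Test whether the count of some element outside the cluster of `u` differs substantially from
that of the representative. -/
def readyCmd (T : ℕ) : Cmd :=
  .seq (.assign 10 (.lit 0) (.lit 0))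
    (.forall_lt 7 (.guard (.and (.not (.bin .eq (.cell 2 (reg 7)) (.cell 2 (reg 3))))
        (farExpr T (.cell 9 (reg 7)) refCount))
      (.assign 10 (.lit 0) (.lit 1))))

/-- Ask the oracle whether `v` belongs to the cluster of `u`, or assume that it does. -/
def confirmCmd : Bool → Cmd
  | true => .query 5 (.lit 0) (reg 7) (.bin .sub (.cell 2 (reg 3)) (.lit 1))
  | false => .assign 5 (.lit 0) (.lit 1)

/-- If the test was positive, add to the cluster of `u` all unclassified elements with similar
counts. -/
def absorbCmd (conf : Bool) (T : ℕ) : Cmd :=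
  .forall_lt 7 (.guard (.and (reg 10) (.and (.not (.cell 2 (reg 7)))
      (.not (farExpr T (.cell 9 (reg 7)) refCount))))
    (.seq (confirmCmd conf) (.guard (reg 5) (.assign 2 (reg 7) (.cell 2 (reg 3))))))

/-- `T₁` is the threshold for detecting that a symbol separates, and `T₂`, chosen smaller, the
threshold for classifying once this is known. -/
def symbolCmd (conf : Bool) (T₁ T₂ : ℕ) : Cmd :=
  .seq countCmd (.seq (readyCmd T₁) (absorbCmd conf T₂))

/-- The symbols are tried by a loop over all numbers below `n`; those that are not below `q` never
occur and have count zero. -/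
def stageCmd (conf : Bool) (T₁ T₂ : ℕ) : Cmd :=
  .guard (.not (.cell 2 (reg 3)))
    (.seq classifyCmd (.forall_lt 6 (symbolCmd conf T₁ T₂)))

def mainCmd (conf : Bool) (T₁ T₂ : ℕ) : Cmd :=
  .seq logCmd (.forall_lt 3 (stageCmd conf T₁ T₂))

theorem ok_mainCmd (conf : Bool) (T₁ T₂ : ℕ) : (mainCmd conf T₁ T₂).Ok := by
  cases conf <;>
  simp [mainCmd, logCmd, stageCmd, classifyCmd, searchCmd, symbolCmd, countCmd, tallyCmd,
    readyCmd, absorbCmd, confirmCmd, Cmd.Ok, Cmd.Writes, Expr.Additive]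

/-! ### Effect of the parts of the program -/

theorem run_logCmd (O : ℕ → ℕ → Bool) {s : Mem × ℕ} {n : ℕ} (hn : s.1 0 0 = n) (hpos : 0 < n)
    (h11 : s.1 11 0 = 0) :
    n < 2 ^ (logCmd.run O s).1 11 0 ∧ 2 ^ (logCmd.run O s).1 11 0 ≤ 2 * n ∧
      (logCmd.run O s).2 = s.2 := by
  have key := Cmd.run_forall_lt O (x := 13)
    (c := .guard (.bin .lt (reg 12) (.bin .add (reg 0) (.lit 1)))
      (.seq (.assign 12 (.lit 0) (.bin .add (reg 12) (reg 12)))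
        (.assign 11 (.lit 0) (.bin .add (reg 11) (.lit 1)))))
    (by simp [Cmd.Ok, Cmd.Writes, Expr.Additive])
    (s := (upd s.1 12 0 1, s.2)) (n := n) (by simp [upd_apply, hn])
    -- As long as the power of two is at most `n`, every round has doubled it. Not exceeding `n`
    -- after `n` rounds would thus mean `2 ^ n ≤ n`.
    (fun i t => t.1 12 0 = 2 ^ t.1 11 0 ∧ t.1 12 0 ≤ 2 * n ∧ (t.1 12 0 ≤ n → t.1 11 0 = i) ∧
      t.2 = s.2)
    (by intro i t y h; simpa [upd_apply] using h)
    (by simp [upd_apply, h11]; omega)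
    (by
      rintro i hi t - hf ⟨h1, h2, h3, h4⟩
      have h0 : t.1 0 0 = n := by
        rw [hf 0 (by simp [Cmd.Writes])]
        simp [upd_apply, hn]
      rw [Cmd.run_guard]
      split_ifs with hlt <;>
        simp only [Expr.holds_lt, Expr.val, Op.eval, h0] at hlt
      · simp only [Cmd.run, Expr.val, Op.eval, upd_apply]
        simp only [and_true, if_true]
        norm_num
        refine ⟨by rw [h1, pow_succ]; ring, by omega, fun _ => h3 (by omega), h4⟩
      · exact ⟨h1, h2, fun h => by omega, h4⟩)
  obtain ⟨h1, h2, h3, h4⟩ := key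
  change _ < 2 ^ ((Cmd.forall_lt 13 _).run O (upd s.1 12 0 1, s.2)).1 11 0 ∧
    2 ^ ((Cmd.forall_lt 13 _).run O (upd s.1 12 0 1, s.2)).1 11 0 ≤ _ ∧
    ((Cmd.forall_lt 13 _).run O (upd s.1 12 0 1, s.2)).2 = _
  refine ⟨?_, h1 ▸ h2, h4⟩
  by_contra hlt
  have h5 := h3 (by rw [h1]; exact not_lt.1 hlt)
  rw [h5] at hlt
  exact hlt Nat.lt_two_pow_self

/-- The number computed by `countCmd`. -/
def symCount (n : ℕ) (W lab : ℕ → ℕ) (u x v : ℕ) : ℕ :=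
  ((Finset.range n).filter fun a =>
    a ≤ u ∧ lab a = lab u ∧ a + 1 ≠ lab u ∧ W (pos n v a) = x).card

theorem run_tallyCmd (O : ℕ → ℕ → Bool) {s : Mem × ℕ} {n : ℕ} (hn : s.1 0 0 = n) :
    (tallyCmd.run O s).1 9 = Function.update (s.1 9) (s.1 7 0) (s.1 9 (s.1 7 0) +
      symCount n (s.1 1) (s.1 2) (s.1 3 0) (s.1 6 0) (s.1 7 0)) ∧ (tallyCmd.run O s).2 = s.2 := by
  refine Cmd.run_forall_lt O (x := 8) (by simp [Cmd.Ok, Cmd.Writes, Expr.Additive]) hn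
    (fun i t => t.1 9 = Function.update (s.1 9) (s.1 7 0) (s.1 9 (s.1 7 0) +
      ((Finset.range i).filter fun a => a ≤ s.1 3 0 ∧ s.1 2 a = s.1 2 (s.1 3 0) ∧
        a + 1 ≠ s.1 2 (s.1 3 0) ∧ s.1 1 (pos n (s.1 7 0) a) = s.1 6 0).card) ∧ t.2 = s.2)
    ?_ ?_ ?_
  · intro i t y h
    dsimp only
    rwa [upd_of_ne _ _ _ (by norm_num)]
  · simp
  · rintro i hi t hti hf ⟨h1, h2⟩
    have f : ∀ a, a ≠ 8 → a ≠ 9 → t.1 a = s.1 a := fun a h h' => hf a (by simp [Cmd.Writes, h, h'])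
    rw [Cmd.run_guard]
    have hg : countGuard.Holds t.1 ↔ i ≤ s.1 3 0 ∧ s.1 2 i = s.1 2 (s.1 3 0) ∧
        i + 1 ≠ s.1 2 (s.1 3 0) ∧ s.1 1 (pos n (s.1 7 0) i) = s.1 6 0 := by
      simp only [countGuard, Expr.holds_and, Expr.holds_not, Expr.holds_lt, Expr.holds_eq,
        Expr.val, Op.eval, val_posExpr, hti]
      rw [f 0, f 1, f 2, f 3, f 6, f 7, hn, Nat.lt_succ_iff] <;> norm_num
    rw [Finset.range_add_one, Finset.filter_insert]
    by_cases h : countGuard.Holds t.1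
    · rw [if_pos h, if_pos (hg.1 h), Finset.card_insert_of_notMem (by simp)]
      refine ⟨?_, h2⟩
      simp only [Cmd.run, Expr.val, Op.eval, upd, Function.update_self]
      rw [f 7 (by norm_num) (by norm_num), h1]
      simp [add_assoc]
    · rw [if_neg h, if_neg (fun h' => h (hg.2 h'))]
      exact ⟨h1, h2⟩

theorem run_countCmd (O : ℕ → ℕ → Bool) {s : Mem × ℕ} {n : ℕ} (hn : s.1 0 0 = n) :
    (∀ v < n, (countCmd.run O s).1 9 v = symCount n (s.1 1) (s.1 2) (s.1 3 0) (s.1 6 0) v) ∧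
      (countCmd.run O s).2 = s.2 := by
  refine Cmd.run_forall_lt O (x := 7) (by simp [tallyCmd, Cmd.Ok, Cmd.Writes, Expr.Additive]) hn
    (fun i t => (∀ v < i, t.1 9 v = symCount n (s.1 1) (s.1 2) (s.1 3 0) (s.1 6 0) v) ∧
      t.2 = s.2) ?_ ?_ ?_
  · intro i t y h
    dsimp only
    rwa [upd_of_ne _ _ _ (by norm_num)]
  · simp
  · rintro i hi t hti hf ⟨h1, h2⟩
    have f : ∀ a, a ≠ 7 → a ≠ 8 → a ≠ 9 → t.1 a = s.1 a :=
      fun a h h' h'' => hf a (by simp [Cmd.Writes, tallyCmd, h, h', h''])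
    have h := run_tallyCmd O (s := (upd t.1 9 i 0, t.2)) (n := n)
      (by simp [upd_apply, f 0, hn])
    simp only [upd_apply, upd_of_ne t.1 (a := 9) (b := 1) _ _ (by norm_num),
      upd_of_ne t.1 (a := 9) (b := 2) _ _ (by norm_num)] at h
    norm_num [hti, f 1, f 2, f 3, f 6] at h
    simp only [Cmd.run, Expr.val, hti]
    refine ⟨fun v hv => ?_, h.2.trans h2⟩
    rw [h.1]
    by_cases hvi : v = i
    · simp [hvi]
    · rw [Function.update_of_ne hvi, upd_apply, if_neg (by simp [hvi]), h1 v (by omega)]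

theorem run_readyCmd (O : ℕ → ℕ → Bool) (T : ℕ) {s : Mem × ℕ} {n : ℕ} (hn : s.1 0 0 = n) :
    (((readyCmd T).run O s).1 10 0 ≠ 0 ↔ ∃ v < n, s.1 2 v ≠ s.1 2 (s.1 3 0) ∧
      Far T (s.1 11 0) (s.1 9 v) (s.1 9 (s.1 2 (s.1 3 0) - 1))) ∧
      ((readyCmd T).run O s).2 = s.2 := by
  refine Cmd.run_forall_lt O (x := 7) (s := (upd s.1 10 0 0, s.2)) (n := n)
    (by simp [Cmd.Ok, Cmd.Writes, Expr.Additive]) (by simp [upd_apply, hn])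
    (fun i t => (t.1 10 0 ≠ 0 ↔ ∃ v < i, s.1 2 v ≠ s.1 2 (s.1 3 0) ∧
      Far T (s.1 11 0) (s.1 9 v) (s.1 9 (s.1 2 (s.1 3 0) - 1))) ∧ t.2 = s.2) ?_ ?_ ?_
  · intro i t y h
    dsimp only
    rwa [upd_of_ne _ _ _ (by norm_num)]
  · simp [upd_apply]
  · rintro i hi t hti hf ⟨h1, h2⟩
    have f : ∀ a, a ≠ 7 → a ≠ 10 → t.1 a = s.1 a := fun a h h' => by
      rw [hf a (by simp [Cmd.Writes, h, h'])]
      exact upd_of_ne _ _ _ h'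
    rw [Cmd.run_guard]
    split_ifs with h <;> simp only [Expr.holds_and, Expr.holds_not, Expr.holds_eq, holds_farExpr,
      refCount, Expr.val, Op.eval, hti] at h <;>
    rw [f 2 (by norm_num) (by norm_num), f 3 (by norm_num) (by norm_num),
      f 9 (by norm_num) (by norm_num), f 11 (by norm_num) (by norm_num)] at h
    · refine ⟨?_, h2⟩
      simp only [Cmd.run, Expr.val, upd_apply]
      simp only [true_and, if_true, ne_eq, one_ne_zero, not_false_iff, true_iff]
      exact ⟨i, Nat.lt_succ_self i, h⟩
    · refine ⟨h1.trans ⟨fun ⟨v, hv, h'⟩ => ⟨v, by omega, h'⟩, fun ⟨v, hv, hw⟩ => ⟨v, ?_, hw⟩⟩, h2⟩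
      rcases Nat.lt_succ_iff_lt_or_eq.1 hv with hv | rfl
      · exact hv
      · exact absurd hw h

/-- The elements that `absorbCmd` tries to add to the cluster of `u`. -/
def Candidate (m : Mem) (T v : ℕ) : Prop :=
  m 10 0 ≠ 0 ∧ m 2 v = 0 ∧ ¬ Far T (m 11 0) (m 9 v) (m 9 (m 2 (m 3 0) - 1))

-- Candidates are described by the memory before the loop although the loop changes labels: round
-- `i` reads only the labels of `i`, not yet touched, and of `u`, which could only be overwritten by
-- itself.
open Classical in
theorem run_absorbCmd (O : ℕ → ℕ → Bool) (conf : Bool) (T : ℕ) {s : Mem × ℕ} {n : ℕ}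
    (hn : s.1 0 0 = n) :
    (∀ v, ((absorbCmd conf T).run O s).1 2 v =
      if v < n ∧ Candidate s.1 T v ∧ (conf = true → O v (s.1 2 (s.1 3 0) - 1) = true)
      then s.1 2 (s.1 3 0) else s.1 2 v) ∧
      ((absorbCmd conf T).run O s).2 = s.2 + if conf = true then
        ((Finset.range n).filter fun v => Candidate s.1 T v).card else 0 := by
  refine Cmd.run_forall_lt O (x := 7)
    (by cases conf <;> simp [Cmd.Ok, Cmd.Writes, confirmCmd, Expr.Additive]) hn
    (fun i t => (∀ v, t.1 2 v =
      if v < i ∧ Candidate s.1 T v ∧ (conf = true → O v (s.1 2 (s.1 3 0) - 1) = true)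
      then s.1 2 (s.1 3 0) else s.1 2 v) ∧
      t.2 = s.2 + if conf = true then
        ((Finset.range i).filter fun v => Candidate s.1 T v).card else 0) ?_ ?_ ?_
  · intro i t y h
    dsimp only
    rwa [upd_of_ne _ _ _ (by norm_num)]
  · simp
  · rintro i hi t hti hf ⟨h1, h2⟩
    have f : ∀ a, a ≠ 7 → a ≠ 5 → a ≠ 2 → t.1 a = s.1 a := fun a h h' h'' =>
      hf a (by cases conf <;> simp [Cmd.Writes, confirmCmd, h, h', h''])
    have f3 := f 3 (by norm_num) (by norm_num) (by norm_num)
    have hlu : t.1 2 (s.1 3 0) = s.1 2 (s.1 3 0) := by rw [h1]; split_ifs <;> rfl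
    have hli : t.1 2 i = s.1 2 i := by rw [h1, if_neg]; simp
    rw [Cmd.run_guard]
    have hg : (Expr.and (reg 10) (.and (.not (.cell 2 (reg 7)))
        (.not (farExpr T (.cell 9 (reg 7)) refCount)))).Holds t.1 ↔ Candidate s.1 T i := by
      simp only [Expr.holds_and, Expr.holds_not, holds_farExpr, refCount, Candidate]
      simp only [Expr.Holds, Expr.val, Op.eval, hti, f3, hlu, hli]
      rw [f 9 (by norm_num) (by norm_num) (by norm_num),
        f 10 (by norm_num) (by norm_num) (by norm_num),
        f 11 (by norm_num) (by norm_num) (by norm_num)]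
      simp
    have hlt : ∀ v, v < i + 1 ↔ v = i ∨ v < i := by omega
    by_cases hc : Candidate s.1 T i
    · rw [if_pos (hg.2 hc), Finset.range_add_one, Finset.filter_insert, if_pos hc,
        Finset.card_insert_of_notMem (by simp)]
      set t' := (confirmCmd conf).run O t with ht'
      have g2 : t'.1 2 = t.1 2 :=
        Cmd.run_of_not_writes O (by cases conf <;> simp [confirmCmd, Cmd.Writes]) t
      have g3 : t'.1 3 = s.1 3 :=
        (Cmd.run_of_not_writes O (by cases conf <;> simp [confirmCmd, Cmd.Writes]) t).trans f3
      have g7 : t'.1 7 = t.1 7 :=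
        Cmd.run_of_not_writes O (by cases conf <;> simp [confirmCmd, Cmd.Writes]) t
      have g5 : t'.1 5 0 ≠ 0 ↔ (conf = true → O i (s.1 2 (s.1 3 0) - 1) = true) := by
        cases conf
        · simp [ht', confirmCmd, Cmd.run, upd_apply, Expr.val]
        · simp [ht', confirmCmd, Cmd.run, upd_apply, Expr.val, Op.eval, hti, f3, hlu]
      have gq : t'.2 = t.2 + if conf = true then 1 else 0 := by
        cases conf <;> simp [ht', confirmCmd, Cmd.run]
      rw [Cmd.run, ← ht', Cmd.run_guard]
      have hq : t'.2 = s.2 + if conf = true then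
          ((Finset.range i).filter fun v => Candidate s.1 T v).card + 1 else 0 := by
        rw [gq, h2]
        split_ifs <;> omega
      by_cases h5 : (reg 5).Holds t'.1 <;> [rw [if_pos h5]; rw [if_neg h5]]
      · refine ⟨fun v => ?_, hq⟩
        simp only [Cmd.run, Expr.val, upd_apply, g2, g3, g7, hti, hlu, h1, true_and]
        by_cases hv : v = i
        · subst hv
          rw [if_pos rfl, if_pos ⟨Nat.lt_succ_self v, hc, g5.1 h5⟩]
        · simp [hv, hlt]
      · refine ⟨fun v => ?_, hq⟩
        rw [g2, h1]
        by_cases hv : v = i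
        · subst hv
          rw [if_neg (by simp), if_neg fun h => h5 (g5.2 h.2.2)]
        · simp [hv, hlt]
    · rw [if_neg (mt hg.1 hc), Finset.range_add_one, Finset.filter_insert, if_neg hc]
      refine ⟨fun v => ?_, h2⟩
      rw [h1]
      by_cases hv : v = i
      · subst hv
        simp [hc]
      · simp [hv, hlt]

/-- The number of representatives. -/
def repCount (n : ℕ) (lab : ℕ → ℕ) : ℕ := ((Finset.range n).filter fun r => lab r = r + 1).card

theorem run_classifyCmd (O : ℕ → ℕ → Bool) {s : Mem × ℕ} {n : ℕ}
    (hn : s.1 0 0 = n) (hun : s.1 3 0 < n) (hu : s.1 2 (s.1 3 0) = 0) :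
    ∃ r < n, (classifyCmd.run O s).1 2 = Function.update (s.1 2) (s.1 3 0) (r + 1) ∧
      (r = s.1 3 0 ∧ (∀ r' < n, s.1 2 r' = r' + 1 → O (s.1 3 0) r' = false) ∨
        s.1 2 r = r + 1 ∧ O (s.1 3 0) r = true) ∧
      (classifyCmd.run O s).2 ≤ s.2 + repCount n (s.1 2) := by
  set u := s.1 3 0 with hudef
  have key := Cmd.run_forall_lt O (x := 4)
    (c := .guard (.and (.not (.cell 2 (reg 3)))
        (.bin .eq (.cell 2 (reg 4)) (.bin .add (reg 4) (.lit 1))))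
      (.seq (.query 5 (.lit 0) (reg 3) (reg 4))
        (.guard (reg 5) (.assign 2 (reg 3) (.bin .add (reg 4) (.lit 1))))))
    (by simp [Cmd.Ok, Cmd.Writes, Expr.Additive]) hn
    -- Either no representative has matched so far, or `u` has received its label and the guard
    -- blocks all further queries.
    (fun i t => (t.1 2 = s.1 2 ∧ (∀ r' < i, s.1 2 r' = r' + 1 → O u r' = false) ∨
        ∃ r < n, t.1 2 = Function.update (s.1 2) u (r + 1) ∧ s.1 2 r = r + 1 ∧ O u r = true) ∧
      t.2 ≤ s.2 + ((Finset.range i).filter fun r => s.1 2 r = r + 1).card)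
    (by
      intro i t y h
      dsimp only
      rwa [upd_of_ne _ _ _ (by norm_num)])
    (by simp)
    (by
      rintro i hi t hti hf ⟨h1, h2⟩
      have f3 : t.1 3 0 = u := by rw [hf 3 (by simp [Cmd.Writes])]
      have hmono : ((Finset.range i).filter fun r => s.1 2 r = r + 1).card ≤
          ((Finset.range (i + 1)).filter fun r => s.1 2 r = r + 1).card :=
        Finset.card_le_card (Finset.filter_subset_filter _ (Finset.range_mono (Nat.le_succ i)))
      have hg : (Expr.and (.not (.cell 2 (reg 3)))
          (.bin .eq (.cell 2 (reg 4)) (.bin .add (reg 4) (.lit 1)))).Holds t.1 ↔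
          t.1 2 u = 0 ∧ t.1 2 i = i + 1 := by
        simp only [Expr.holds_and, Expr.holds_not, Expr.holds_eq]
        simp only [Expr.Holds, Expr.val, Op.eval, hti, f3, not_not]
      rw [Cmd.run_guard]
      rcases h1 with ⟨h1, h1'⟩ | ⟨r, hr, h1, hr1, hr2⟩
      · rw [h1] at hg
        split_ifs with h <;> rw [hg] at h
        · rw [Finset.range_add_one, Finset.filter_insert, if_pos h.2,
            Finset.card_insert_of_notMem (by simp)]
          simp only [Cmd.run, Expr.val, Op.eval, f3, hti, upd_apply]
          simp only [true_and, if_true]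
          by_cases hO : O u i = true
          · refine ⟨Or.inr ⟨i, hi, ?_, h.2, hO⟩, ?_⟩
            · simp only [hO, Bool.toNat_true, one_ne_zero, if_false]
              funext j
              simp [upd_apply, h1, Function.update_apply]
            · simp only [hO, Bool.toNat_true, one_ne_zero, if_false]
              omega
          · simp only [Bool.not_eq_true] at hO
            refine ⟨Or.inl ⟨?_, fun r' hr' hrep => ?_⟩, ?_⟩
            · simp only [hO, Bool.toNat_false, if_true]
              rw [upd_of_ne _ _ _ (by norm_num), h1]
            · rcases Nat.lt_succ_iff_lt_or_eq.1 hr' with h' | rfl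
              · exact h1' r' h' hrep
              · exact hO
            · simp only [hO, Bool.toNat_false, if_true]
              omega
        · refine ⟨Or.inl ⟨h1, fun r' hr' hrep => ?_⟩, h2.trans (by omega)⟩
          rcases Nat.lt_succ_iff_lt_or_eq.1 hr' with h' | rfl
          · exact h1' r' h' hrep
          · exact absurd ⟨hu, hrep⟩ h
      · rw [if_neg (by rw [hg]; simp [h1])]
        exact ⟨Or.inr ⟨r, hr, h1, hr1, hr2⟩, h2.trans (by omega)⟩)
  change (_ ∨ _) ∧ (searchCmd.run O s).2 ≤ _ at key
  obtain ⟨h1, h2⟩ := key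
  have f3 : (searchCmd.run O s).1 3 0 = u := by
    rw [Cmd.run_of_not_writes O (by simp [Cmd.Writes, searchCmd]) s]
  have hrun : classifyCmd.run O s = (Cmd.guard (.not (.cell 2 (reg 3)))
    (.assign 2 (reg 3) (.bin .add (reg 3) (.lit 1)))).run O (searchCmd.run O s) := rfl
  have hg : (Expr.not (.cell 2 (reg 3))).Holds (searchCmd.run O s).1 ↔
      (searchCmd.run O s).1 2 u = 0 := by
    rw [Expr.holds_not]
    simp only [Expr.Holds, Expr.val, f3, not_not]
  rw [hrun, Cmd.run_guard]
  rcases h1 with ⟨h1, h1'⟩ | ⟨r, hr, h1, hr1, hr2⟩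
  · change (searchCmd.run O s).1 2 = _ at h1
    rw [if_pos (by rw [hg, h1, hu])]
    refine ⟨u, hun, ?_, Or.inl ⟨rfl, h1'⟩, h2⟩
    simp [Cmd.run, upd, Expr.val, Op.eval, f3, h1]
  · change (searchCmd.run O s).1 2 = _ at h1
    rw [if_neg (by rw [hg]; simp [h1])]
    exact ⟨r, hr, h1, Or.inr ⟨hr1, hr2⟩, h2⟩

/-! ### Correctness and number of queries -/

/-- The answers of the oracle describe an equivalence relation on the numbers below `n`. -/
structure IsEquivalenceOracle (n : ℕ) (O : ℕ → ℕ → Bool) : Prop where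
  refl : ∀ u < n, O u u = true
  symm : ∀ u v, O u v = true → O v u = true
  trans : ∀ u v w, O u v = true → O v w = true → O u w = true

/-- Every label refers to a representative of the right cluster, and every cluster has at most one
representative. -/
structure Consistent (O : ℕ → ℕ → Bool) (n : ℕ) (lab : ℕ → ℕ) : Prop where
  exists_rep : ∀ v < n, lab v ≠ 0 → ∃ r < n, lab v = r + 1 ∧ lab r = r + 1 ∧ O v r = true
  rep_unique : ∀ r < n, ∀ r' < n, lab r = r + 1 → lab r' = r' + 1 → O r r' = true → r = r'

section

variable {n : ℕ} {O : ℕ → ℕ → Bool} {lab lab' : ℕ → ℕ}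

theorem Consistent.label_eq_iff (h : Consistent O n lab) (hO : IsEquivalenceOracle n O) {v w : ℕ}
    (hv : v < n) (hw : w < n) (hv0 : lab v ≠ 0) (hw0 : lab w ≠ 0) :
    lab v = lab w ↔ O v w = true := by
  obtain ⟨r, hr, hvr, hrr, hor⟩ := h.exists_rep v hv hv0
  obtain ⟨r', hr', hwr, hrr', hor'⟩ := h.exists_rep w hw hw0
  constructor
  · intro e
    have : r = r' := by omega
    subst this
    exact hO.trans _ _ _ hor (hO.symm _ _ hor')
  · intro e
    have := h.rep_unique r hr r' hr' hrr hrr'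
      (hO.trans _ _ _ (hO.symm _ _ hor) (hO.trans _ _ _ e hor'))
    omega

/-- Extending a consistent labelling to further elements of the clusters found. -/
theorem Consistent.extend (h : Consistent O n lab)
    (h' : ∀ v < n, lab' v = lab v ∨
      lab v = 0 ∧ ∃ r < n, lab r = r + 1 ∧ lab' v = r + 1 ∧ O v r = true) :
    Consistent O n lab' := by
  have hkeep : ∀ v < n, lab v ≠ 0 → lab' v = lab v := fun v hv h0 =>
    (h' v hv).resolve_right fun h'' => h0 h''.1
  -- No representative is created: a newly labelled element points to an old representative, which
  -- was labelled before and hence is a different element.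
  have hrep : ∀ r < n, lab' r = r + 1 → lab r = r + 1 := fun r hr hr' => by
    rcases h' r hr with h1 | ⟨h1, r', -, h2, h3, -⟩
    · rw [← h1, hr']
    · have : r' = r := by omega
      subst this
      omega
  refine ⟨fun v hv h0 => ?_, fun r hr r' hr' h1 h2 => h.rep_unique r hr r' hr' (hrep r hr h1)
    (hrep r' hr' h2)⟩
  rcases h' v hv with h1 | ⟨-, r, hr, h2, h3, h4⟩
  · rw [h1] at h0 ⊢
    obtain ⟨r, hr, h2, h3, h4⟩ := h.exists_rep v hv h0
    exact ⟨r, hr, h2, by rw [hkeep r hr (by omega), h3], h4⟩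
  · exact ⟨r, hr, h3, by rw [hkeep r hr (by omega), h2], h4⟩

theorem Consistent.classify (h : Consistent O n lab) (hO : IsEquivalenceOracle n O) {u r : ℕ}
    (hu : u < n) (hr : r < n) (hu0 : lab u = 0)
    (hur : r = u ∧ (∀ r' < n, lab r' = r' + 1 → O u r' = false) ∨ lab r = r + 1 ∧ O u r = true) :
    Consistent O n (Function.update lab u (r + 1)) := by
  rcases hur with ⟨rfl, hnew⟩ | ⟨hrr, hor⟩
  · refine ⟨fun v hv h0 => ?_, fun r₁ h₁ r₂ h₂ e₁ e₂ ho => ?_⟩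
    · by_cases hvr : v = r
      · subst hvr
        exact ⟨v, hv, by simp, by simp, hO.refl v hv⟩
      · rw [Function.update_of_ne hvr] at h0 ⊢
        obtain ⟨r', hr', h2, h3, h4⟩ := h.exists_rep v hv h0
        have : r' ≠ r := by rintro rfl; omega
        exact ⟨r', hr', h2, by rw [Function.update_of_ne this, h3], h4⟩
    · by_cases h₁r : r₁ = r <;> by_cases h₂r : r₂ = r
      · rw [h₁r, h₂r]
      · rw [Function.update_of_ne h₂r] at e₂
        rw [h₁r] at ho
        simp [hnew r₂ h₂ e₂] at ho
      · rw [Function.update_of_ne h₁r] at e₁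
        rw [h₂r] at ho
        have := hO.symm _ _ ho
        simp [hnew r₁ h₁ e₁] at this
      · rw [Function.update_of_ne h₁r] at e₁
        rw [Function.update_of_ne h₂r] at e₂
        exact h.rep_unique r₁ h₁ r₂ h₂ e₁ e₂ ho
  · refine h.extend fun v hv => ?_
    by_cases hvu : v = u
    · subst hvu
      exact Or.inr ⟨hu0, r, hr, hrr, by simp, hor⟩
    · exact Or.inl (Function.update_of_ne hvu _ _)

/-- The test of `readyCmd` for the symbol `x` is positive. -/
def Ready (n : ℕ) (W lab : ℕ → ℕ) (L T u x : ℕ) : Prop :=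
  ∃ v < n, lab v ≠ lab u ∧
    Far T L (symCount n W lab u x v) (symCount n W lab u x (lab u - 1))

/-- The elements that are candidates for the cluster of `u`, on the basis of the symbol `x`. -/
def IsCandidate (n : ℕ) (W lab : ℕ → ℕ) (L T₁ T₂ u x v : ℕ) : Prop :=
  Ready n W lab L T₁ u x ∧ lab v = 0 ∧
    ¬ Far T₂ L (symCount n W lab u x v) (symCount n W lab u x (lab u - 1))

open Classical in
theorem run_symbolCmd (O : ℕ → ℕ → Bool) (conf : Bool) (T₁ T₂ : ℕ) {s : Mem × ℕ} {n u x L : ℕ}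
    (hn : s.1 0 0 = n) (hu : s.1 3 0 = u) (hx : s.1 6 0 = x) (hL : s.1 11 0 = L)
    (hr : s.1 2 u - 1 < n) :
    (∀ v, ((symbolCmd conf T₁ T₂).run O s).1 2 v =
      if v < n ∧ IsCandidate n (s.1 1) (s.1 2) L T₁ T₂ u x v ∧
        (conf = true → O v (s.1 2 u - 1) = true) then s.1 2 u else s.1 2 v) ∧
      ((symbolCmd conf T₁ T₂).run O s).2 = s.2 + if conf = true then
        ((Finset.range n).filter fun v => IsCandidate n (s.1 1) (s.1 2) L T₁ T₂ u x v).card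
        else 0 := by
  obtain ⟨hc, hcq⟩ := run_countCmd O hn
  set s₁ := countCmd.run O s with hs₁
  have f₁ : ∀ a, a ≠ 7 → a ≠ 8 → a ≠ 9 → s₁.1 a = s.1 a := fun a h h' h'' =>
    Cmd.run_of_not_writes O (by simp [countCmd, tallyCmd, Cmd.Writes, h, h', h'']) s
  have hn₁ : s₁.1 0 0 = n := by rw [f₁ 0 (by norm_num) (by norm_num) (by norm_num), hn]
  obtain ⟨hd, hdq⟩ := run_readyCmd O T₁ hn₁
  set s₂ := (readyCmd T₁).run O s₁ with hs₂
  have f₂ : ∀ a, a ≠ 7 → a ≠ 10 → s₂.1 a = s₁.1 a := fun a h h' =>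
    Cmd.run_of_not_writes O (by simp [readyCmd, Cmd.Writes, h, h']) s₁
  have hn₂ : s₂.1 0 0 = n := by rw [f₂ 0 (by norm_num) (by norm_num), hn₁]
  obtain ⟨he, heq⟩ := run_absorbCmd O conf T₂ hn₂
  have g2 : s₂.1 2 = s.1 2 := (f₂ 2 (by norm_num) (by norm_num)).trans
    (f₁ 2 (by norm_num) (by norm_num) (by norm_num))
  have g3 : s₂.1 3 = s.1 3 := (f₂ 3 (by norm_num) (by norm_num)).trans
    (f₁ 3 (by norm_num) (by norm_num) (by norm_num))
  have g11 : s₂.1 11 = s.1 11 := (f₂ 11 (by norm_num) (by norm_num)).trans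
    (f₁ 11 (by norm_num) (by norm_num) (by norm_num))
  have g9 : s₂.1 9 = s₁.1 9 := f₂ 9 (by norm_num) (by norm_num)
  rw [hu, hx] at hc
  rw [f₁ 2 (by norm_num) (by norm_num) (by norm_num),
    f₁ 3 (by norm_num) (by norm_num) (by norm_num),
    f₁ 11 (by norm_num) (by norm_num) (by norm_num), hu, hL, hc _ hr] at hd
  have hcand : ∀ v < n, (Candidate s₂.1 T₂ v ↔
      IsCandidate n (s.1 1) (s.1 2) L T₁ T₂ u x v) := fun v hv => by
    rw [Candidate, IsCandidate, hd, g2, g3, g9, g11, hu, hL, hc v hv, hc _ hr, Ready]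
    refine and_congr_left fun _ => exists_congr fun w => and_congr_right fun hw => ?_
    rw [hc w hw]
  refine ⟨fun v => ?_, ?_⟩
  · refine (he v).trans ?_
    rw [g2, g3, hu]
    refine if_congr (and_congr_right fun hv => ?_) rfl rfl
    rw [hcand v hv]
  · refine heq.trans ?_
    rw [hdq, hcq]
    congr 2
    refine congrArg _ (Finset.filter_congr fun v hv => hcand v (Finset.mem_range.1 hv))

theorem run_stageCmd_of_ne_zero (conf : Bool) (T₁ T₂ : ℕ) {t : Mem × ℕ}
    (h : t.1 2 (t.1 3 0) ≠ 0) : (stageCmd conf T₁ T₂).run O t = t := by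
  rw [stageCmd, Cmd.run_guard, if_neg]
  rw [Expr.holds_not]
  simpa [Expr.Holds, Expr.val] using h

theorem run_stageCmd_of_eq_zero (conf : Bool) (T₁ T₂ : ℕ) {t : Mem × ℕ}
    (h : t.1 2 (t.1 3 0) = 0) : (stageCmd conf T₁ T₂).run O t =
      (Cmd.forall_lt 6 (symbolCmd conf T₁ T₂)).run O (classifyCmd.run O t) := by
  rw [stageCmd, Cmd.run_guard, if_pos]
  · rfl
  · rw [Expr.holds_not]
    simpa [Expr.Holds, Expr.val] using h

theorem not_writes_classifyCmd {a : ℕ} (h2 : a ≠ 2) (h4 : a ≠ 4) (h5 : a ≠ 5) :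
    ¬ classifyCmd.Writes a := by
  simp [classifyCmd, searchCmd, Cmd.Writes, h2, h4, h5]

theorem not_writes_symbolCmd (conf : Bool) (T₁ T₂ : ℕ) {a : ℕ} (h2 : a ≠ 2) (h5 : a ≠ 5)
    (h7 : a ≠ 7) (h8 : a ≠ 8) (h9 : a ≠ 9) (h10 : a ≠ 10) :
    ¬ (symbolCmd conf T₁ T₂).Writes a := by
  cases conf <;> simp [symbolCmd, countCmd, tallyCmd, readyCmd, absorbCmd, confirmCmd, Cmd.Writes,
    h2, h5, h7, h8, h9, h10]

theorem not_writes_stageCmd (conf : Bool) (T₁ T₂ : ℕ) {a : ℕ} (ha : a ≤ 1 ∨ 11 ≤ a) :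
    ¬ (Cmd.forall_lt 3 (stageCmd conf T₁ T₂)).Writes a := by
  cases conf <;> simp [stageCmd, classifyCmd, searchCmd, symbolCmd, countCmd, tallyCmd, readyCmd,
    absorbCmd, confirmCmd, Cmd.Writes] <;> omega

theorem ok_stages (conf : Bool) (T₁ T₂ : ℕ) : (Cmd.forall_lt 3 (stageCmd conf T₁ T₂)).Ok :=
  (ok_mainCmd conf T₁ T₂).2

theorem ok_symbols (conf : Bool) (T₁ T₂ : ℕ) : (Cmd.forall_lt 6 (symbolCmd conf T₁ T₂)).Ok :=
  (ok_stages conf T₁ T₂).2.1.2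

/-- With confirmation by queries, the final labelling is correct. -/
theorem consistent_of_confirm (hO : IsEquivalenceOracle n O) (T₁ T₂ : ℕ) {s : Mem × ℕ}
    (hn : s.1 0 0 = n) (hs : ∀ v, s.1 2 v = 0) :
    Consistent O n (((Cmd.forall_lt 3 (stageCmd true T₁ T₂)).run O s).1 2) ∧
      ∀ v < n, ((Cmd.forall_lt 3 (stageCmd true T₁ T₂)).run O s).1 2 v ≠ 0 := by
  refine Cmd.run_forall_lt O (ok_stages true T₁ T₂) hn
    (fun i t => Consistent O n (t.1 2) ∧ ∀ v < i, t.1 2 v ≠ 0) ?_ ?_ ?_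
  · intro i t y h
    dsimp only
    rwa [upd_of_ne _ _ _ (by norm_num)]
  · refine ⟨⟨fun v _ h0 => absurd (hs v) h0, fun r _ r' _ h => ?_⟩, by simp⟩
    rw [hs] at h
    omega
  · rintro u hu t htu hf ⟨h1, h2⟩
    by_cases h0 : t.1 2 u = 0
    · have ht0 : t.1 0 0 = n := by rw [hf 0 (not_writes_stageCmd _ _ _ (by norm_num)), hn]
      rw [run_stageCmd_of_eq_zero _ _ _ (by rwa [htu])]
      obtain ⟨r, hr, hlab, hrep, -⟩ := run_classifyCmd O ht0 (by omega) (by rwa [htu])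
      rw [htu] at hlab hrep
      set t₁ := classifyCmd.run O t
      have f0 : t₁.1 0 0 = n := by
        rw [Cmd.run_of_not_writes O (not_writes_classifyCmd _ _ _) t, ht0] <;> norm_num
      have f3 : t₁.1 3 0 = u := by
        rw [Cmd.run_of_not_writes O (not_writes_classifyCmd _ _ _) t, htu] <;> norm_num
      refine Cmd.run_forall_lt O (ok_symbols true T₁ T₂) f0
        (fun _ t => Consistent O n (t.1 2) ∧ ∀ v < u + 1, t.1 2 v ≠ 0) ?_ ?_ ?_
      · intro i t y h
        dsimp only
        rwa [upd_of_ne _ _ _ (by norm_num)]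
      · rw [hlab]
        refine ⟨h1.classify hO hu hr h0 hrep, fun v hv => ?_⟩
        by_cases hvu : v = u
        · simp [hvu]
        · rw [Function.update_of_ne hvu]
          exact h2 v (by omega)
      · rintro x hx t₂ htx hf₂ ⟨h3, h4⟩
        have f0' : t₂.1 0 0 = n := by
          rw [hf₂ 0 fun h => h.elim (by norm_num) (not_writes_symbolCmd true T₁ T₂ (by norm_num)
            (by norm_num) (by norm_num) (by norm_num) (by norm_num) (by norm_num)), f0]
        have f3' : t₂.1 3 0 = u := by
          rw [hf₂ 3 fun h => h.elim (by norm_num) (not_writes_symbolCmd true T₁ T₂ (by norm_num)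
            (by norm_num) (by norm_num) (by norm_num) (by norm_num) (by norm_num)), f3]
        obtain ⟨r, hr, hur, hrr, -⟩ := h3.exists_rep u hu (h4 u (Nat.lt_succ_self u))
        obtain ⟨h5, -⟩ := run_symbolCmd O true T₁ T₂ f0' f3' htx rfl (by omega)
        refine ⟨h3.extend fun v _ => ?_, fun v hv => ?_⟩
        · rw [h5]
          split_ifs with hif
          · refine Or.inr ⟨hif.2.1.2.1, r, hr, hrr, hur, ?_⟩
            have := hif.2.2 rfl
            rwa [hur, Nat.add_sub_cancel] at this
          · exact Or.inl rfl
        · rw [h5]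
          split_ifs with hif
          · exact h4 u (Nat.lt_succ_self u)
          · exact h4 v hv
    · rw [run_stageCmd_of_ne_zero _ _ _ (by rwa [htu])]
      refine ⟨h1, fun v hv => ?_⟩
      rcases Nat.lt_succ_iff_lt_or_eq.1 hv with h | rfl
      · exact h2 v h
      · exact h0

/-! ### Symbol counts in terms of the true clustering -/

/-- The number of elements of the cluster of `u`, up to `u` and without `r`, whose similarity to `v`
is `x`. -/
def clusterCount (n : ℕ) (W : ℕ → ℕ) (O : ℕ → ℕ → Bool) (u r x v : ℕ) : ℕ :=
  ((Finset.range n).filter fun a => a ≤ u ∧ O a u = true ∧ a ≠ r ∧ W (pos n v a) = x).card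

/-- At stage `u` everything up to `u` is labelled, and labels agree with clusters there. So the set
over which the program counts does not depend on the similarity matrix except through the
representative, and that one is left arbitrary in the union bound. -/
theorem Consistent.symCount_eq (h : Consistent O n lab) (hO : IsEquivalenceOracle n O)
    {u : ℕ} (hu : u < n) (hlab : ∀ v ≤ u, lab v ≠ 0) (W : ℕ → ℕ) (x v : ℕ) :
    symCount n W lab u x v = clusterCount n W O u (lab u - 1) x v := by
  refine congrArg _ (Finset.filter_congr fun a ha => and_congr_right fun hau => ?_)
  rw [h.label_eq_iff hO (Finset.mem_range.1 ha) hu (hlab a hau) (hlab u le_rfl)]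
  have := hlab u le_rfl
  refine and_congr_right fun _ => and_congr_left fun _ => ?_
  omega

/-- The number of elements of the cluster of `v` before `u`. -/
def rank (O : ℕ → ℕ → Bool) (u v : ℕ) : ℕ := ((Finset.range u).filter fun a => O a v = true).card

theorem rank_succ (u v : ℕ) : rank O (u + 1) v = rank O u v + if O u v = true then 1 else 0 := by
  rw [rank, Finset.range_add_one, Finset.filter_insert]
  split_ifs
  · rw [Finset.card_insert_of_notMem (by simp)]
    rfl
  · rfl

theorem IsEquivalenceOracle.rank_congr (hO : IsEquivalenceOracle n O) {v w : ℕ}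
    (h : O v w = true) (u : ℕ) : rank O u v = rank O u w :=
  congrArg Finset.card (Finset.filter_congr fun _ _ =>
    ⟨fun h' => hO.trans _ _ _ h' h, fun h' => hO.trans _ _ _ h' (hO.symm _ _ h)⟩)

/-- What the similarity matrix `W` has to satisfy: whenever the test for a cluster is positive, it
separates the cluster from all other elements, and the test is positive as soon as more than `M`
elements of the cluster have been processed. -/
structure Separates (n : ℕ) (W : ℕ → ℕ) (O : ℕ → ℕ → Bool) (L T₁ T₂ M : ℕ) : Prop where
  separates : ∀ u < n, ∀ r < n, O r u = true → ∀ x w, w < n → ¬ (w ≤ u ∧ O w u = true ∧ w ≠ r) →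
    Far T₁ L (clusterCount n W O u r x w) (clusterCount n W O u r x r) →
    ∀ v < n, ¬ (v ≤ u ∧ O v u = true ∧ v ≠ r) →
      (¬ Far T₂ L (clusterCount n W O u r x v) (clusterCount n W O u r x r) ↔ O v u = true)
  ready : ∀ u < n, ∀ r < n, O r u = true → M ≤ rank O u u → ∃ v < n, O v u = false ∧
    ∃ x < n, Far T₁ L (clusterCount n W O u r x v) (clusterCount n W O u r x r)

def labCount (n : ℕ) (lab : ℕ → ℕ) : ℕ := ((Finset.range n).filter fun v => lab v ≠ 0).card

/-- The labelling after the cluster of `u` has been completed. -/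
def completed (n : ℕ) (O : ℕ → ℕ → Bool) (lab : ℕ → ℕ) (u v : ℕ) : ℕ :=
  if v < n ∧ lab v = 0 ∧ O v u = true then lab u else lab v

theorem Consistent.completed (h : Consistent O n lab) (hO : IsEquivalenceOracle n O) {u : ℕ}
    (hu : u < n) (hu0 : lab u ≠ 0) : Consistent O n (completed n O lab u) := by
  obtain ⟨r, hr, hur, hrr, hor⟩ := h.exists_rep u hu hu0
  refine h.extend fun v _ => ?_
  rw [QueryCluster.completed]
  split_ifs with hif
  · exact Or.inr ⟨hif.2.1, r, hr, hrr, hur, hO.trans _ _ _ hif.2.2 hor⟩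
  · exact Or.inl rfl

theorem completed_ne_zero {u v : ℕ} (hu : lab u ≠ 0) (h : lab v ≠ 0) :
    completed n O lab u v ≠ 0 := by
  rw [completed]
  split_ifs <;> assumption

/-- Several symbols may pass the test in one stage; all but the first then change nothing. -/
theorem completed_completed (u v : ℕ) (hu : lab u ≠ 0) :
    completed n O (completed n O lab u) u v = completed n O lab u v := by
  have : completed n O lab u u = lab u := by rw [completed]; split_ifs <;> rfl
  rw [completed, this]
  split_ifs with h
  · rw [completed]
    have h1 := h.2.1
    rw [completed] at h1
    split_ifs at h1 with h2
    · exact absurd h1 hu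
    · exact absurd ⟨h.1, h1, h.2.2⟩ h2
  · rfl

/-- The element `w` behind a positive test has a label different from that of `u`, but it might be a
still unlabelled member of the cluster. What matters for `Separates.separates` is that `w` is not
among the counted elements. Neither is an unlabelled `v`, since everything up to `u` is labelled. -/
theorem isCandidate_iff {W : ℕ → ℕ} {L T₁ T₂ M : ℕ} (hW : Separates n W O L T₁ T₂ M)
    (hO : IsEquivalenceOracle n O) (h : Consistent O n lab) {u x : ℕ} (hu : u < n)
    (hlab : ∀ v ≤ u, lab v ≠ 0) (hready : Ready n W lab L T₁ u x) {v : ℕ} (hv : v < n) :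
    IsCandidate n W lab L T₁ T₂ u x v ↔ lab v = 0 ∧ O v u = true := by
  have hu0 := hlab u le_rfl
  obtain ⟨r, hr, hur, hrr, hor⟩ := h.exists_rep u hu hu0
  have hr' : lab u - 1 = r := by omega
  rw [IsCandidate, and_iff_right hready]
  refine and_congr_right fun hv0 => ?_
  obtain ⟨w, hw, hwu, hfar⟩ := hready
  simp only [h.symCount_eq hO hu hlab, hr'] at hfar ⊢
  refine hW.separates u hu r hr (hO.symm _ _ hor) x w hw ?_ hfar v hv
    fun h' => hlab v h'.1 hv0
  rintro ⟨hle, ho, -⟩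
  exact hwu ((h.label_eq_iff hO hw hu (hlab w hle) hu0).2 ho)

-- The number of labelled elements serves as a potential for the confirming queries: each of them
-- succeeds and labels one new element. The identity is written with sums because subtraction is
-- truncated.
open Classical in
theorem run_symbolCmd_of_separates {W : ℕ → ℕ} {L T₁ T₂ M : ℕ} (hW : Separates n W O L T₁ T₂ M)
    (hO : IsEquivalenceOracle n O) (conf : Bool) {s : Mem × ℕ} {u x : ℕ}
    (hn : s.1 0 0 = n) (hsW : s.1 1 = W) (hsu : s.1 3 0 = u) (hx : s.1 6 0 = x)
    (hL : s.1 11 0 = L) (h : Consistent O n (s.1 2)) (hu : u < n) (hlab : ∀ v ≤ u, s.1 2 v ≠ 0) :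
    (¬ Ready n W (s.1 2) L T₁ u x ∧ ((symbolCmd conf T₁ T₂).run O s).1 2 = s.1 2 ∨
      ((symbolCmd conf T₁ T₂).run O s).1 2 = completed n O (s.1 2) u) ∧
    ((symbolCmd conf T₁ T₂).run O s).2 + (if conf = true then labCount n (s.1 2) else 0) =
      s.2 + if conf = true then labCount n (((symbolCmd conf T₁ T₂).run O s).1 2) else 0 := by
  have hu0 := hlab u le_rfl
  obtain ⟨r, hr, hur, hrr, hor⟩ := h.exists_rep u hu hu0
  have hr' : s.1 2 u - 1 = r := by omega
  obtain ⟨h1, h2⟩ := run_symbolCmd O conf T₁ T₂ hn hsu hx hL (by omega)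
  rw [hsW] at h1 h2
  rw [h2]
  by_cases hready : Ready n W (s.1 2) L T₁ u x
  · have hcand := fun v (hv : v < n) => isCandidate_iff hW hO h hu hlab hready hv
    have hnew : ((symbolCmd conf T₁ T₂).run O s).1 2 = completed n O (s.1 2) u := by
      funext v
      rw [h1, completed]
      refine if_congr (and_congr_right fun hv => ?_) rfl rfl
      rw [hcand v hv, and_assoc]
      refine and_congr_right fun _ => ⟨fun h => h.1, fun h => ⟨h, fun _ => ?_⟩⟩
      rw [hr']
      exact hO.trans _ _ _ h hor
    refine ⟨Or.inr hnew, ?_⟩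
    rw [hnew]
    split_ifs with hc
    · rw [Finset.filter_congr fun v hv => hcand v (Finset.mem_range.1 hv), add_assoc,
        labCount, labCount, ← Finset.card_union_of_disjoint]
      · congr 2
        ext v
        simp only [Finset.mem_union, Finset.mem_filter, Finset.mem_range]
        rw [completed]
        by_cases hv : v < n <;> by_cases hv0 : s.1 2 v = 0 <;> by_cases hov : O v u = true <;>
          simp [hv, hv0, hov, hu0]
      · rw [Finset.disjoint_filter]
        exact fun v _ h h' => h' h.1
    · rfl
  · have hnot : ∀ v, ¬ IsCandidate n W (s.1 2) L T₁ T₂ u x v := fun v hv => hready hv.1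
    have hnew : ((symbolCmd conf T₁ T₂).run O s).1 2 = s.1 2 := by
      funext v
      rw [h1, if_neg fun h => hnot v h.2.1]
    refine ⟨Or.inl ⟨hready, hnew⟩, ?_⟩
    rw [hnew]
    simp [hnot]

/-! ### Invariant of the stages -/

/-- The state of the labelling before stage `u`. -/
structure StageInvariant (O : ℕ → ℕ → Bool) (n M u : ℕ) (lab : ℕ → ℕ) : Prop where
  consistent : Consistent O n lab
  labelled : ∀ v < u, lab v ≠ 0
  complete : ∀ v < n, u ≤ v → lab v ≠ 0 → ∀ w < n, O w v = true → lab w ≠ 0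
  rank_le : ∀ v < n, lab v = 0 → rank O u v ≤ M

theorem labCount_mono (h : ∀ v, lab v ≠ 0 → lab' v ≠ 0) : labCount n lab ≤ labCount n lab' :=
  Finset.card_le_card (Finset.monotone_filter_right _ fun v _ => h v)

theorem run_symbols_of_separates {W : ℕ → ℕ} {L T₁ T₂ M : ℕ} (hW : Separates n W O L T₁ T₂ M)
    (hO : IsEquivalenceOracle n O) (conf : Bool) {s : Mem × ℕ} {u : ℕ}
    (hn : s.1 0 0 = n) (hsW : s.1 1 = W) (hsu : s.1 3 0 = u)
    (hL : s.1 11 0 = L) (h : Consistent O n (s.1 2)) (hu : u < n) (hlab : ∀ v ≤ u, s.1 2 v ≠ 0) :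
    ((∀ x < n, ¬ Ready n W (s.1 2) L T₁ u x) ∧
        ((Cmd.forall_lt 6 (symbolCmd conf T₁ T₂)).run O s).1 2 = s.1 2 ∨
      ((Cmd.forall_lt 6 (symbolCmd conf T₁ T₂)).run O s).1 2 = completed n O (s.1 2) u) ∧
    ((Cmd.forall_lt 6 (symbolCmd conf T₁ T₂)).run O s).2 +
        (if conf = true then labCount n (s.1 2) else 0) =
      s.2 + if conf = true then
        labCount n (((Cmd.forall_lt 6 (symbolCmd conf T₁ T₂)).run O s).1 2) else 0 := by
  refine Cmd.run_forall_lt O (ok_symbols conf T₁ T₂) hn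
    (fun i t => ((∀ x < i, ¬ Ready n W (s.1 2) L T₁ u x) ∧ t.1 2 = s.1 2 ∨
      t.1 2 = completed n O (s.1 2) u) ∧
      t.2 + (if conf = true then labCount n (s.1 2) else 0) =
        s.2 + if conf = true then labCount n (t.1 2) else 0) ?_ ?_ ?_
  · intro i t y h
    dsimp only
    rwa [upd_of_ne _ _ _ (by norm_num)]
  · simp
  · rintro x hx t htx hf ⟨h1, h2⟩
    have f : ∀ a, a ≠ 2 → a ≠ 5 → a ≠ 7 → a ≠ 8 → a ≠ 9 → a ≠ 10 → a ≠ 6 → t.1 a = s.1 a :=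
      fun a h2 h5 h7 h8 h9 h10 h6 => hf a fun h => h.elim h6
        (not_writes_symbolCmd conf T₁ T₂ h2 h5 h7 h8 h9 h10)
    have hu0 := hlab u le_rfl
    have ht : Consistent O n (t.1 2) ∧ ∀ v ≤ u, t.1 2 v ≠ 0 := by
      rcases h1 with ⟨-, h1⟩ | h1 <;> rw [h1]
      · exact ⟨h, hlab⟩
      · exact ⟨h.completed hO hu hu0, fun v hv => completed_ne_zero hu0 (hlab v hv)⟩
    obtain ⟨h3, h4⟩ := run_symbolCmd_of_separates hW hO conf (s := t) (u := u) (x := x)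
      (by rw [f 0, hn] <;> norm_num) (by rw [f 1, hsW] <;> norm_num)
      (by rw [f 3, hsu] <;> norm_num) htx (by rw [f 11, hL] <;> norm_num) ht.1 hu ht.2
    refine ⟨?_, by omega⟩
    rcases h1 with ⟨h1', h1⟩ | h1 <;> rw [h1] at h3
    · rcases h3 with ⟨h3', h3⟩ | h3
      · refine Or.inl ⟨fun x' hx' => ?_, h3⟩
        rcases Nat.lt_succ_iff_lt_or_eq.1 hx' with h | rfl
        · exact h1' x' h
        · exact h3'
      · exact Or.inr h3
    · rcases h3 with ⟨-, h3⟩ | h3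
      · exact Or.inr h3
      · refine Or.inr (h3.trans ?_)
        funext v
        exact completed_completed u v hu0

/-- An element labelled before its turn was absorbed together with its whole cluster, so no
unlabelled element gains a predecessor in its cluster. -/
theorem StageInvariant.step_labelled {M u : ℕ} (h : StageInvariant O n M u lab)
    (hO : IsEquivalenceOracle n O) (hu : u < n) (hu0 : lab u ≠ 0) :
    StageInvariant O n M (u + 1) lab := by
  refine ⟨h.consistent, fun v hv => ?_, fun v hv huv => h.complete v hv (by omega),
    fun v hv h0 => ?_⟩
  · rcases Nat.lt_succ_iff_lt_or_eq.1 hv with h' | rfl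
    · exact h.labelled v h'
    · exact hu0
  · rw [rank_succ, if_neg, add_zero]
    · exact h.rank_le v hv h0
    · exact fun ho => h.complete u hu le_rfl hu0 v hv (hO.symm _ _ ho) h0

/-- If no symbol passes the test, then fewer than `M` members of the cluster precede `u`, so its
unlabelled members have at most `M` predecessors including `u`. If one passes, the cluster has no
unlabelled members left. Other clusters are unaffected. -/
theorem StageInvariant.step {W : ℕ → ℕ} {L T₁ T₂ M u r : ℕ} (hW : Separates n W O L T₁ T₂ M)
    (h : StageInvariant O n M u lab)
    (hO : IsEquivalenceOracle n O) (hu : u < n) {lab₁ : ℕ → ℕ}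
    (hlab₁ : lab₁ = Function.update lab u (r + 1)) (hc : Consistent O n lab₁)
    (h' : (∀ x < n, ¬ Ready n W lab₁ L T₁ u x) ∧ lab' = lab₁ ∨
      lab' = QueryCluster.completed n O lab₁ u) :
    StageInvariant O n M (u + 1) lab' := by
  have hu₁ : lab₁ u ≠ 0 := by simp [hlab₁]
  have hne : ∀ v, v ≠ u → lab₁ v = lab v := fun v hv => by rw [hlab₁, Function.update_of_ne hv]
  have hle : ∀ v ≤ u, lab₁ v ≠ 0 := fun v hv => by
    by_cases hvu : v = u
    · rwa [hvu]
    · rw [hne v hvu]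
      exact h.labelled v (by omega)
  have hmono : ∀ v, lab v ≠ 0 → lab₁ v ≠ 0 := fun v hv => by
    by_cases hvu : v = u
    · rwa [hvu]
    · rwa [hne v hvu]
  have hrank : ∀ v < n, lab₁ v = 0 → O u v = false → rank O (u + 1) v ≤ M := fun v hv h0 ho => by
    rw [rank_succ, if_neg (by simp [ho]), add_zero]
    refine h.rank_le v hv ?_
    by_contra h0'
    exact hmono v h0' h0
  rcases h' with ⟨hready, rfl⟩ | rfl
  · refine ⟨hc, fun v hv => hle v (by omega), fun v hv huv h0 w hw how => ?_, fun v hv h0 => ?_⟩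
    · rw [hne v (by omega)] at h0
      exact hmono w (h.complete v hv (by omega) h0 w hw how)
    · by_cases ho : O u v = true
      · rw [rank_succ, if_pos ho, ← hO.rank_congr ho]
        -- More than `M` predecessors counting `u` means at least `M` not counting it, which is the
        -- hypothesis of `Separates.ready`.
        by_contra hM
        obtain ⟨r', hr', hur, -, hor⟩ := hc.exists_rep u hu hu₁
        obtain ⟨w, hw, how, x, hx, hfar⟩ :=
          hW.ready u hu r' hr' (hO.symm _ _ hor) (by omega)
        refine hready x hx ⟨w, hw, fun e => ?_, ?_⟩
        · have := (hc.label_eq_iff hO hw hu (e ▸ hu₁) hu₁).1 e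
          simp [how] at this
        · rwa [hc.symCount_eq hO hu hle, hc.symCount_eq hO hu hle,
            show lab' u - 1 = r' by omega]
      · exact hrank v hv h0 (by simpa using ho)
  · have hcomp : ∀ v < n, O v u = true → QueryCluster.completed n O lab₁ u v ≠ 0 := by
      intro v hv ho
      by_cases h0 : lab₁ v = 0
      · rw [QueryCluster.completed, if_pos ⟨hv, h0, ho⟩]
        exact hu₁
      · exact completed_ne_zero hu₁ h0
    refine ⟨hc.completed hO hu hu₁, fun v hv => completed_ne_zero hu₁ (hle v (by omega)),
      fun v hv huv h0 w hw how => ?_, fun v hv h0 => ?_⟩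
    · by_cases ho : O v u = true
      · exact hcomp w hw (hO.trans _ _ _ how ho)
      · rw [QueryCluster.completed, if_neg fun h => ho h.2.2, hne v (by omega)] at h0
        exact completed_ne_zero hu₁ (hmono w (h.complete v hv (by omega) h0 w hw how))
    · refine hrank v hv ?_ ?_
      · by_contra h0'
        exact completed_ne_zero hu₁ h0' h0
      · by_contra ho
        exact hcomp v hv (hO.symm _ _ (by simpa using ho)) h0

/-! ### Counting the queries -/

/-- The elements below `u` preceded by at most `M` elements of their cluster. -/
def earlyCount (O : ℕ → ℕ → Bool) (M u : ℕ) : ℕ :=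
  ((Finset.range u).filter fun a => rank O a a ≤ M).card

theorem earlyCount_succ (M u : ℕ) :
    earlyCount O M (u + 1) = earlyCount O M u + if rank O u u ≤ M then 1 else 0 := by
  rw [earlyCount, Finset.range_add_one, Finset.filter_insert]
  split_ifs
  · rw [Finset.card_insert_of_notMem (by simp)]
    rfl
  · rfl

/-- If the similarity matrix separates the clusters, then the final labelling is correct, and the
number of queries is bounded. -/
theorem run_stages_of_separates {W : ℕ → ℕ} {L T₁ T₂ M K : ℕ} (hW : Separates n W O L T₁ T₂ M)
    (hO : IsEquivalenceOracle n O) (conf : Bool)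
    (hK : ∀ lab, Consistent O n lab → repCount n lab ≤ K) {s : Mem × ℕ}
    (hn : s.1 0 0 = n) (hsW : s.1 1 = W) (hL : s.1 11 0 = L) (hs : ∀ v, s.1 2 v = 0)
    (hsq : s.2 = 0) :
    (Consistent O n (((Cmd.forall_lt 3 (stageCmd conf T₁ T₂)).run O s).1 2) ∧
      ∀ v < n, ((Cmd.forall_lt 3 (stageCmd conf T₁ T₂)).run O s).1 2 v ≠ 0) ∧
    ((Cmd.forall_lt 3 (stageCmd conf T₁ T₂)).run O s).2 ≤
      K * earlyCount O M n + if conf = true then n else 0 := by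
  have key := Cmd.run_forall_lt O (ok_stages conf T₁ T₂) hn
    (fun u t => StageInvariant O n M u (t.1 2) ∧
      t.2 ≤ K * earlyCount O M u + if conf = true then labCount n (t.1 2) else 0) ?_ ?_ ?_
  · refine ⟨⟨key.1.consistent, key.1.labelled⟩, key.2.trans ?_⟩
    split_ifs
    · refine Nat.add_le_add_left ?_ _
      exact (Finset.card_filter_le _ _).trans (Finset.card_range n).le
    · exact le_rfl
  · intro i t y h
    dsimp only
    rwa [upd_of_ne _ _ _ (by norm_num)]
  · refine ⟨⟨⟨fun v _ h0 => absurd (hs v) h0, fun r _ r' _ h => ?_⟩, by simp,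
      fun v _ _ h0 => absurd (hs v) h0, by simp [rank]⟩, by omega⟩
    rw [hs] at h
    omega
  · rintro u hu t htu hf ⟨h1, h2⟩
    have hearly := earlyCount_succ (O := O) M u
    by_cases h0 : t.1 2 u = 0
    · have ht0 : t.1 0 0 = n := by rw [hf 0 (not_writes_stageCmd _ _ _ (by norm_num)), hn]
      have ht1 : t.1 1 = W := by rw [hf 1 (not_writes_stageCmd _ _ _ (by norm_num)), hsW]
      have ht11 : t.1 11 0 = L := by rw [hf 11 (not_writes_stageCmd _ _ _ (by norm_num)), hL]
      rw [run_stageCmd_of_eq_zero _ _ _ (by rwa [htu])]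
      obtain ⟨r, hr, hlab, hrep, hq⟩ := run_classifyCmd O ht0 (by omega) (by rwa [htu])
      rw [htu] at hlab hrep
      set t₁ := classifyCmd.run O t
      have f : ∀ a, a ≠ 2 → a ≠ 4 → a ≠ 5 → t₁.1 a = t.1 a := fun a h2 h4 h5 =>
        Cmd.run_of_not_writes O (not_writes_classifyCmd h2 h4 h5) t
      have hc : Consistent O n (t₁.1 2) := by
        rw [hlab]
        exact h1.consistent.classify hO hu hr h0 hrep
      obtain ⟨h3, h4⟩ := run_symbols_of_separates hW hO conf (s := t₁) (u := u)
        (by rw [f 0, ht0] <;> norm_num) (by rw [f 1, ht1] <;> norm_num)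
        (by rw [f 3, htu] <;> norm_num) (by rw [f 11, ht11] <;> norm_num) hc hu
        (fun v hv => by
          rw [hlab]
          by_cases hvu : v = u
          · simp [hvu]
          · rw [Function.update_of_ne hvu]
            exact h1.labelled v (by omega))
      refine ⟨h1.step hW hO hu hlab hc h3, ?_⟩
      -- As `u` is still unlabelled, it has at most `M` predecessors in its cluster; the increase of
      -- `earlyCount` pays for its at most `K` search queries.
      rw [if_pos (h1.rank_le u hu h0)] at hearly
      have hK' := hK _ h1.consistent
      have hmono : labCount n (t.1 2) ≤ labCount n (t₁.1 2) := labCount_mono fun v hv => by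
        rw [hlab]
        by_cases hvu : v = u
        · simp [hvu]
        · rwa [Function.update_of_ne hvu]
      rw [hearly, mul_add, mul_one]
      split_ifs at h2 h4 ⊢ <;> omega
    · rw [run_stageCmd_of_ne_zero _ _ _ (by rwa [htu])]
      refine ⟨h1.step_labelled hO hu h0, h2.trans ?_⟩
      exact Nat.add_le_add_right (Nat.mul_le_mul_left _ (by omega)) _

end

/-! ### Concentration of symbol counts -/

theorem sum_toReal {q : ℕ} (f : PMF (Fin q)) : ∑ y, (f y).toReal = 1 := by
  rw [← ENNReal.toReal_sum fun y _ => f.apply_ne_top y, ← tsum_fintype (L := .unconditional _),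
    f.tsum_coe, ENNReal.toReal_one]

section

variable {ι : Type*} [Fintype ι] {q : ℕ}

theorem integral_ite_eq (f : PMF (Fin q)) (x : Fin q) (a : ℝ) :
    ∫ y, (if y = x then a else 1) ∂f.toMeasure = 1 + (f x).toReal * (a - 1) := by
  have : ∀ y, (f y).toReal • (if y = x then a else 1) =
      (f y).toReal + if y = x then (f y).toReal * (a - 1) else 0 := fun y => by
    split_ifs
    · rw [smul_eq_mul]; ring
    · rw [smul_eq_mul]; ring
  rw [PMF.integral_eq_sum, Finset.sum_congr rfl fun y _ => this y, Finset.sum_add_distrib,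
    sum_toReal]
  simp

/-- The number of indices in `S` with symbol `x`. -/
def indexCount (S : Finset ι) (x : Fin q) (W : ι → Fin q) : ℕ := (S.filter fun p => W p = x).card

/-- By independence the moment generating function is a power of `1 + f(x) (e^t - 1)`, and `1 + z ≤
e^z` gives the Poisson bound, which depends on the mean only. -/
theorem mgf_indexCount_le (F : ι → PMF (Fin q)) (S : Finset ι) {f : PMF (Fin q)}
    (hF : ∀ p ∈ S, F p = f) (x : Fin q) (t : ℝ) :
    ProbabilityTheory.mgf (fun W => (indexCount S x W : ℝ))
      (Measure.pi fun p => (F p).toMeasure) t ≤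
      Real.exp (S.card * (f x).toReal * (Real.exp t - 1)) := by
  classical
  have hprod : ∀ W : ι → Fin q, Real.exp (t * (indexCount S x W : ℝ)) =
      ∏ p, if p ∈ S then (if W p = x then Real.exp t else 1) else 1 := fun W => by
    rw [Finset.prod_ite_mem, Finset.univ_inter, Finset.prod_ite, Finset.prod_const_one, mul_one,
      Finset.prod_const, ← Real.exp_nat_mul, mul_comm]
    rfl
  rw [ProbabilityTheory.mgf, integral_congr_ae (Filter.Eventually.of_forall hprod),
    integral_fintype_prod_eq_prod
      (fun p y => if p ∈ S then (if y = x then Real.exp t else 1) else 1)]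
  have hfactor : ∀ p, ∫ y, (if p ∈ S then (if y = x then Real.exp t else 1) else 1)
      ∂(F p).toMeasure = if p ∈ S then 1 + (f x).toReal * (Real.exp t - 1) else 1 := fun p => by
    split_ifs with h
    · rw [hF p h, integral_ite_eq]
    · simp
  rw [Finset.prod_congr rfl fun p _ => hfactor p, Finset.prod_ite_mem, Finset.univ_inter,
    Finset.prod_const, mul_assoc, Real.exp_nat_mul]
  refine pow_le_pow_left₀ ?_ ?_ _
  · rw [← integral_ite_eq]
    exact integral_nonneg fun y => by dsimp only; split_ifs <;> positivity
  · rw [add_comm]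
    exact Real.add_one_le_exp _

/-- The exponent of the Chernoff bound at the optimal parameter. -/
theorem chernoff_exponent {m y : ℝ} (hm : 0 < m) (hy : 0 < y) :
    -Real.log (y ^ 2 / m) * y ^ 2 + m * (Real.exp (Real.log (y ^ 2 / m)) - 1) ≤
      -(y - √m) ^ 2 := by
  have hs : 0 < √m := Real.sqrt_pos.2 hm
  have hsq : √m ^ 2 = m := Real.sq_sqrt hm.le
  rw [Real.exp_log (by positivity)]
  have h1 : Real.log (y ^ 2 / m) = 2 * Real.log (y / √m) := by
    rw [← hsq, ← div_pow, Real.log_pow]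
    simp
  -- With `log z ≥ 1 - 1/z` at `z = y / √m` the exponent becomes a perfect square, for `y` on either
  -- side of `√m`; so both tails are covered.
  have h2 := Real.one_sub_inv_le_log_of_pos (div_pos hy hs)
  have h3 : (1 - (y / √m)⁻¹) * y ^ 2 = y ^ 2 - √m * y := by field_simp
  have h4 : m * (y ^ 2 / m - 1) = y ^ 2 - m := by field_simp
  have h5 : (1 - (y / √m)⁻¹) * y ^ 2 ≤ Real.log (y / √m) * y ^ 2 :=
    mul_le_mul_of_nonneg_right h2 (sq_nonneg y)
  rw [h1, h4]
  nlinarith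

/-- Chernoff's bound on the square root scale, where the variance is stabilised: the tail does not
depend on the mean, so one deviation `ρ` serves for all sets, symbols and laws. -/
theorem measure_sqrt_indexCount_ge (F : ι → PMF (Fin q)) (S : Finset ι) {f : PMF (Fin q)}
    (hF : ∀ p ∈ S, F p = f) (x : Fin q) {ρ : ℝ} (hρ : 0 ≤ ρ) :
    (Measure.pi fun p => (F p).toMeasure).real
      {W | √(S.card * (f x).toReal) + ρ < √(indexCount S x W)} ≤ Real.exp (-ρ ^ 2) := by
  set m : ℝ := S.card * (f x).toReal with hmdef
  have hm0 : 0 ≤ m := by positivity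
  set y := √m + ρ with hy
  have hy0 : 0 ≤ y := by positivity
  have hsub : {W : ι → Fin q | y < √(indexCount S x W)} ⊆
      {W | y ^ 2 ≤ (indexCount S x W : ℝ)} := fun W hW => by
    have := Real.lt_sqrt hy0 |>.1 hW
    exact this.le
  refine (measureReal_mono hsub).trans ?_
  rcases hm0.eq_or_lt with hm | hm
  -- For mean zero the optimal parameter does not exist, but the generating function is at most `1`
  -- and any `t ≥ 1` works.
  · refine (ProbabilityTheory.measure_ge_le_exp_mul_mgf (t := 1) (y ^ 2) zero_le_one
      Integrable.of_finite).trans ?_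
    refine (mul_le_mul_of_nonneg_left (mgf_indexCount_le F S hF x 1) (Real.exp_nonneg _)).trans ?_
    rw [← hmdef, ← Real.exp_add, Real.exp_le_exp, hy, ← hm]
    simp
  · have hypos : 0 < y := by positivity
    have ht : 0 ≤ Real.log (y ^ 2 / m) := Real.log_nonneg <| by
      rw [one_le_div hm]
      nlinarith [Real.sq_sqrt hm0, Real.sqrt_nonneg m]
    refine (ProbabilityTheory.measure_ge_le_exp_mul_mgf (y ^ 2) ht Integrable.of_finite).trans ?_
    refine (mul_le_mul_of_nonneg_left (mgf_indexCount_le F S hF x _) (Real.exp_nonneg _)).trans ?_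
    rw [← hmdef, ← Real.exp_add, Real.exp_le_exp]
    refine (chernoff_exponent hm hypos).trans (le_of_eq ?_)
    rw [hy, add_sub_cancel_left]

theorem measure_sqrt_indexCount_le (F : ι → PMF (Fin q)) (S : Finset ι) {f : PMF (Fin q)}
    (hF : ∀ p ∈ S, F p = f) (x : Fin q) {ρ : ℝ} (hρ : 0 ≤ ρ) :
    (Measure.pi fun p => (F p).toMeasure).real
      {W | √(indexCount S x W) < √(S.card * (f x).toReal) - ρ} ≤ Real.exp (-ρ ^ 2) := by
  set m : ℝ := S.card * (f x).toReal with hmdef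
  have hm0 : 0 ≤ m := by positivity
  set y := √m - ρ with hy
  rcases le_or_gt y 0 with hy0 | hypos
  · have : {W : ι → Fin q | √(indexCount S x W) < y} = ∅ := by
      ext W
      simpa using hy0.trans (Real.sqrt_nonneg _)
    rw [this, measureReal_empty]
    positivity
  · have hm : 0 < m := by
      rcases hm0.eq_or_lt with h | h
      · rw [← h, Real.sqrt_zero] at hy
        linarith
      · exact h
    have hsub : {W : ι → Fin q | √(indexCount S x W) < y} ⊆
        {W | (indexCount S x W : ℝ) ≤ y ^ 2} := fun W hW =>
      (Real.sqrt_lt' hypos |>.1 hW).le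
    refine (measureReal_mono hsub).trans ?_
    have ht : Real.log (y ^ 2 / m) ≤ 0 := Real.log_nonpos (by positivity) <| by
      rw [div_le_one hm]
      nlinarith [Real.sq_sqrt hm0, Real.sqrt_nonneg m]
    refine (ProbabilityTheory.measure_le_le_exp_mul_mgf (y ^ 2) ht Integrable.of_finite).trans ?_
    refine (mul_le_mul_of_nonneg_left (mgf_indexCount_le F S hF x _) (Real.exp_nonneg _)).trans ?_
    rw [← hmdef, ← Real.exp_add, Real.exp_le_exp]
    refine (chernoff_exponent hm hypos).trans (le_of_eq ?_)
    rw [hy]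
    ring

/-- Square roots of symbol counts have subgaussian tails. -/
theorem measure_abs_sqrt_indexCount_sub (F : ι → PMF (Fin q)) (S : Finset ι) {f : PMF (Fin q)}
    (hF : ∀ p ∈ S, F p = f) (x : Fin q) {ρ : ℝ} (hρ : 0 ≤ ρ) :
    (Measure.pi fun p => (F p).toMeasure).real
      {W | ρ < |√(indexCount S x W) - √(S.card * (f x).toReal)|} ≤ 2 * Real.exp (-ρ ^ 2) := by
  have hsub : {W : ι → Fin q | ρ < |√(indexCount S x W) - √(S.card * (f x).toReal)|} ⊆
      {W | √(S.card * (f x).toReal) + ρ < √(indexCount S x W)} ∪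
        {W | √(indexCount S x W) < √(S.card * (f x).toReal) - ρ} := fun W hW => by
    change ρ < _ at hW
    rcases lt_abs.1 hW with h | h
    · exact Or.inl (by simp only [Set.mem_ofPred_eq]; linarith)
    · exact Or.inr (by simp only [Set.mem_ofPred_eq]; linarith)
  refine (measureReal_mono hsub).trans ((measureReal_union_le _ _).trans ?_)
  have h1 := measure_sqrt_indexCount_ge F S hF x hρ
  have h2 := measure_sqrt_indexCount_le F S hF x hρ
  linarith

end

/-! ### The similarity matrix separates the clusters with high probability -/

theorem isEquivalenceOracle_oracle {n k : ℕ} (c : Fin n → Fin k) :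
    IsEquivalenceOracle n (oracle c) := by
  refine ⟨fun u hu => by simp [oracle, hu], fun u v h => ?_, fun u v w h h' => ?_⟩
  · unfold oracle at h ⊢
    split_ifs at h with h1
    · rw [dif_pos h1.symm]
      simpa using (of_decide_eq_true h).symm
  · unfold oracle at h h' ⊢
    split_ifs at h h' with h1 h2
    · rw [dif_pos ⟨h1.1, h2.2⟩]
      simpa using (of_decide_eq_true h).trans (of_decide_eq_true h')

theorem oracle_val {n k : ℕ} (c : Fin n → Fin k) (u v : Fin n) :
    oracle c u v = true ↔ c u = c v := by
  simp [oracle]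

theorem repCount_le {n k : ℕ} (c : Fin n → Fin k) {lab : ℕ → ℕ}
    (h : Consistent (oracle c) n lab) : repCount n lab ≤ k := by
  rw [repCount]
  conv_rhs => rw [← Finset.card_fin k]
  by_cases hn : n = 0
  · simp [hn]
  have : NeZero n := ⟨hn⟩
  refine Finset.card_le_card_of_injOn (fun r => c (Fin.ofNat n r)) (fun _ _ => Finset.mem_univ _) ?_
  intro r hr r' hr' e
  simp only [Finset.coe_filter, Set.mem_ofPred_eq, Finset.mem_range] at hr hr'
  refine h.rep_unique r hr.1 r' hr'.1 hr.2 hr'.2 ?_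
  have := (oracle_val c (Fin.ofNat n r) (Fin.ofNat n r')).2 e
  simpa [Fin.ofNat, Nat.mod_eq_of_lt hr.1, Nat.mod_eq_of_lt hr'.1] using this

/-- The position of the unordered pair of two elements in the similarity matrix. -/
def mkPair {n : ℕ} (v a : Fin n) (h : v ≠ a) : Pair n := ⟨(min v a, max v a), min_lt_max.2 h⟩

theorem sideArray_pos {n q : ℕ} (W : Pair n → Fin q) (v a : Fin n) (h : v ≠ a) :
    sideArray W (pos n v a) = W (mkPair v a h) := by
  have hn : 0 < n := v.pos
  have hpos : pos n v a = (max v a : Fin n) + n * (min v a : Fin n) := by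
    -- Truncated subtraction provides minimum and maximum without a case distinction in the program.
    rw [pos, Fin.coe_max, Fin.coe_min, show (v : ℕ) - (v - a) = min (v : ℕ) a by omega,
      show (v : ℕ) + (a - v) = max (v : ℕ) a by omega]
    ring
  have h1 : pos n v a / n = (min v a : Fin n) := by
    rw [hpos, Nat.add_mul_div_left _ _ hn, Nat.div_eq_of_lt (Fin.is_lt _), zero_add]
  have h2 : pos n v a % n = (max v a : Fin n) := by
    rw [hpos, Nat.add_mul_mod_self_left, Nat.mod_eq_of_lt (Fin.is_lt _)]
  have h3 : ((min v a : Fin n) : ℕ) < (max v a : Fin n) :=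
    Fin.lt_def.1 (min_lt_max.2 h)
  rw [sideArray, dif_pos ⟨by rw [h1]; exact Fin.is_lt _, by rw [h2]; exact Fin.is_lt _,
    by rw [h1, h2]; exact h3⟩]
  congr 2
  apply Subtype.ext
  exact Prod.ext (Fin.ext h1) (Fin.ext h2)

/-- The elements of the cluster of `u`, up to `u` and without `r`. -/
def core {n k : ℕ} (c : Fin n → Fin k) (u r : Fin n) : Finset (Fin n) :=
  Finset.univ.filter fun a => a ≤ u ∧ c a = c u ∧ a ≠ r

/-- The entries of the similarity matrix between `v` and the set `core c u r`. -/
def corePairs {n k : ℕ} (c : Fin n → Fin k) (u r v : Fin n) : Finset (Pair n) :=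
  Finset.univ.filter fun p => ∃ a ∈ core c u r, ∃ h : v ≠ a, p = mkPair v a h

theorem mkPair_injective {n : ℕ} {v a b : Fin n} (ha : v ≠ a) (hb : v ≠ b)
    (h : mkPair v a ha = mkPair v b hb) : a = b := by
  have h1 : min v a = min v b := congrArg (fun p : Pair n => p.1.1) h
  have h2 : max v a = max v b := congrArg (fun p : Pair n => p.1.2) h
  have h1' := congrArg Fin.val h1
  have h2' := congrArg Fin.val h2
  rw [Fin.coe_min, Fin.coe_min] at h1'
  rw [Fin.coe_max, Fin.coe_max] at h2'
  exact Fin.ext (by omega)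

theorem card_corePairs {n k : ℕ} (c : Fin n → Fin k) (u r v : Fin n) (hv : v ∉ core c u r) :
    (corePairs c u r v).card = (core c u r).card := by
  have hne : ∀ a ∈ core c u r, v ≠ a := fun a ha e => hv (e ▸ ha)
  refine (Finset.card_bij (fun a ha => mkPair v a (hne a ha)) (fun a ha => ?_)
    (fun a ha b hb h => mkPair_injective _ _ h) fun p hp => ?_).symm
  · exact Finset.mem_filter.2 ⟨Finset.mem_univ _, a, ha, hne a ha, rfl⟩
  · obtain ⟨-, a, ha, h, rfl⟩ := Finset.mem_filter.1 hp
    exact ⟨a, ha, rfl⟩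

theorem clusterCount_eq {n k q : ℕ} (c : Fin n → Fin k) (W : Pair n → Fin q) (u r v : Fin n)
    (hv : v ∉ core c u r) (x : Fin q) :
    clusterCount n (sideArray W) (oracle c) u r x v = indexCount (corePairs c u r v) x W := by
  have hne : ∀ a ∈ core c u r, v ≠ a := fun a ha e => hv (e ▸ ha)
  have hmem : ∀ a : Fin n, a ∈ core c u r ↔ (a : ℕ) ≤ u ∧ oracle c a u = true ∧ (a : ℕ) ≠ r := by
    intro a
    rw [core, Finset.mem_filter, oracle_val, ne_eq, ne_eq, ← Fin.ext_iff]
    simp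
  trans ((core c u r).filter fun a : Fin n => sideArray W (pos n v a) = x).card
  · refine (Finset.card_bij (fun (a : Fin n) _ => (a : ℕ)) (fun a ha => ?_)
      (fun a _ b _ h => Fin.ext h) fun a ha => ?_).symm
    · rw [Finset.mem_filter, hmem] at ha
      exact Finset.mem_filter.2 ⟨Finset.mem_range.2 a.2, ha.1.1, ha.1.2.1, ha.1.2.2, ha.2⟩
    · rw [Finset.mem_filter, Finset.mem_range] at ha
      exact ⟨⟨a, ha.1⟩, Finset.mem_filter.2 ⟨(hmem _).2 ⟨ha.2.1, ha.2.2.1, ha.2.2.2.1⟩,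
        ha.2.2.2.2⟩, rfl⟩
  · refine Finset.card_bij (fun a ha => mkPair v a (hne a (Finset.mem_filter.1 ha).1))
      (fun a ha => ?_) (fun a ha b hb h => mkPair_injective _ _ h) fun p hp => ?_
    · have ha' := Finset.mem_filter.1 ha
      refine Finset.mem_filter.2 ⟨Finset.mem_filter.2
        ⟨Finset.mem_univ _, a, ha'.1, hne a ha'.1, rfl⟩, ?_⟩
      rw [sideArray_pos W v a (hne a ha'.1)] at ha'
      exact Fin.ext ha'.2
    · obtain ⟨hp, hpx⟩ := Finset.mem_filter.1 hp
      obtain ⟨-, a, ha, h, rfl⟩ := Finset.mem_filter.1 hp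
      refine ⟨a, Finset.mem_filter.2 ⟨ha, ?_⟩, rfl⟩
      rw [sideArray_pos W v a h, hpx]

/-- All counted elements lie in the cluster of `u`, so the entries in question are identically
distributed and the tail bound applies. -/
theorem law_corePairs {n k q : ℕ} (c : Fin n → Fin k) (fp fm : PMF (Fin q)) (u r v : Fin n) :
    ∀ p ∈ corePairs c u r v,
      (if c p.1.1 = c p.1.2 then fp else fm) = if c v = c u then fp else fm := by
  intro p hp
  obtain ⟨-, a, ha, h, rfl⟩ := Finset.mem_filter.1 hp
  have hau : c a = c u := (Finset.mem_filter.1 ha).2.2.1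
  refine if_congr ?_ rfl rfl
  rw [← hau, mkPair]
  rcases le_total v a with hle | hle
  · simp [min_eq_left hle, max_eq_right hle]
  · simp [min_eq_right hle, max_eq_left hle, eq_comm]

instance {n k q : ℕ} (c : Fin n → Fin k) (fp fm : PMF (Fin q)) :
    IsProbabilityMeasure (sideLaw c fp fm) := by
  unfold sideLaw
  infer_instance

/-- All counts are close to their expectations. -/
def Concentrated {n k q : ℕ} (c : Fin n → Fin k) (fp fm : PMF (Fin q)) (ρ : ℝ)
    (W : Pair n → Fin q) : Prop :=
  ∀ u r v : Fin n, v ∉ core c u r → ∀ x : Fin q,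
    |√(clusterCount n (sideArray W) (oracle c) u r x v) -
      √((core c u r).card * ((if c v = c u then fp else fm) x).toReal)| ≤ ρ

theorem measure_not_concentrated {n k q : ℕ} (c : Fin n → Fin k) (fp fm : PMF (Fin q)) {ρ : ℝ}
    (hρ : 0 ≤ ρ) : (sideLaw c fp fm).real {W | ¬ Concentrated c fp fm ρ W} ≤
      2 * q * n ^ 3 * Real.exp (-ρ ^ 2) := by
  -- A union bound over the `n ^ 3 * q` choices of `u`, `r`, `v` and the symbol.
  have hsub : {W | ¬ Concentrated c fp fm ρ W} ⊆ ⋃ z : (Fin n × Fin n × Fin n) × Fin q,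
      {W : Pair n → Fin q | z.1.2.2 ∉ core c z.1.1 z.1.2.1 ∧
        ρ < |√(indexCount (corePairs c z.1.1 z.1.2.1 z.1.2.2) z.2 W) -
          √((corePairs c z.1.1 z.1.2.1 z.1.2.2).card *
            ((if c z.1.2.2 = c z.1.1 then fp else fm) z.2).toReal)|} := by
    intro W hW
    change ¬ Concentrated c fp fm ρ W at hW
    unfold Concentrated at hW
    push Not at hW
    obtain ⟨u, r, v, hv, x, h⟩ := hW
    rw [clusterCount_eq c W u r v hv, ← card_corePairs c u r v hv] at h
    exact Set.mem_iUnion.2 ⟨((u, r, v), x), hv, h⟩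
  refine (measureReal_mono hsub (measure_ne_top _ _)).trans
    ((measureReal_iUnion_fintype_le _).trans ?_)
  have hle : ∀ z : (Fin n × Fin n × Fin n) × Fin q, (sideLaw c fp fm).real
      {W : Pair n → Fin q | z.1.2.2 ∉ core c z.1.1 z.1.2.1 ∧
        ρ < |√(indexCount (corePairs c z.1.1 z.1.2.1 z.1.2.2) z.2 W) -
          √((corePairs c z.1.1 z.1.2.1 z.1.2.2).card *
            ((if c z.1.2.2 = c z.1.1 then fp else fm) z.2).toReal)|} ≤
        2 * Real.exp (-ρ ^ 2) := fun z =>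
    (measureReal_mono (fun W hW => hW.2) (measure_ne_top _ _)).trans
      (measure_abs_sqrt_indexCount_sub (fun p : Pair n => if c p.1.1 = c p.1.2 then fp else fm)
        _ (law_corePairs c fp fm z.1.1 z.1.2.1 z.1.2.2) z.2 hρ)
  refine (Finset.sum_le_sum fun z _ => hle z).trans (le_of_eq ?_)
  simp
  ring

/-! ### The integer test on the square root scale, and the Hellinger divergence -/

theorem far_iff_real (T L a b : ℕ) :
    Far T L a b ↔ (T * L : ℝ) * (a + b) < ((a : ℝ) - b) ^ 2 := by
  have h : (((a - b + (b - a)) * (a - b + (b - a)) : ℕ) : ℝ) = ((a : ℝ) - b) ^ 2 := by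
    rcases le_total a b with h | h
    · rw [Nat.sub_eq_zero_of_le h, zero_add]
      push_cast [Nat.cast_sub h]
      ring
    · rw [Nat.sub_eq_zero_of_le h, add_zero]
      push_cast [Nat.cast_sub h]
      ring
  rw [Far, ← h, ← Nat.cast_lt (α := ℝ)]
  push_cast
  rfl

/-- Since `(a - b)² = (√a - √b)² (√a + √b)²` and `a + b ≤ (√a + √b)² ≤ 2 (a + b)`, the test measures
`(√a - √b)²` up to a factor of `2`. This direction and `far_of_lt_sq` use the two sides of the
estimate. -/
theorem Far.lt_sq {T L a b : ℕ} (h : Far T L a b) : (T * L : ℝ) < 2 * (√a - √b) ^ 2 := by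
  rw [far_iff_real] at h
  have ha : √(a : ℝ) ^ 2 = a := Real.sq_sqrt (Nat.cast_nonneg a)
  have hb : √(b : ℝ) ^ 2 = b := Real.sq_sqrt (Nat.cast_nonneg b)
  have hab : (0 : ℝ) ≤ a + b := by positivity
  by_contra hle
  have h1 : ((a : ℝ) - b) ^ 2 = (√a - √b) ^ 2 * (√a + √b) ^ 2 := by
    rw [← mul_pow]
    congr 1
    linear_combination hb - ha
  have h2 : (√(a : ℝ) + √b) ^ 2 ≤ 2 * (a + b) := by nlinarith [sq_nonneg (√(a : ℝ) - √b)]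
  have h3 : (√(a : ℝ) - √b) ^ 2 * (√a + √b) ^ 2 ≤ (√a - √b) ^ 2 * (2 * (a + b)) :=
    mul_le_mul_of_nonneg_left h2 (sq_nonneg _)
  have h4 := mul_le_mul_of_nonneg_right (not_lt.1 hle) hab
  nlinarith

theorem far_of_lt_sq {T L a b : ℕ} (h : (T * L : ℝ) < (√a - √b) ^ 2) : Far T L a b := by
  rw [far_iff_real]
  have ha : √(a : ℝ) ^ 2 = a := Real.sq_sqrt (Nat.cast_nonneg a)
  have hb : √(b : ℝ) ^ 2 = b := Real.sq_sqrt (Nat.cast_nonneg b)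
  have hpos : (0 : ℝ) < a + b := by
    by_contra h0
    have ha0 : (a : ℝ) = 0 := by linarith [Nat.cast_nonneg (α := ℝ) a, Nat.cast_nonneg (α := ℝ) b]
    have hb0 : (b : ℝ) = 0 := by linarith [Nat.cast_nonneg (α := ℝ) a, Nat.cast_nonneg (α := ℝ) b]
    rw [ha0, hb0, sub_self] at h
    have : (0 : ℝ) ≤ T * L := by positivity
    norm_num at h
    linarith
  have h1 : ((a : ℝ) - b) ^ 2 = (√a - √b) ^ 2 * (√a + √b) ^ 2 := by
    rw [← mul_pow]
    congr 1
    linear_combination hb - ha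
  have h2 : (a + b : ℝ) ≤ (√a + √b) ^ 2 := by
    nlinarith [mul_nonneg (Real.sqrt_nonneg (a : ℝ)) (Real.sqrt_nonneg (b : ℝ))]
  rw [h1]
  calc (T * L : ℝ) * (a + b) < (√a - √b) ^ 2 * (a + b) := mul_lt_mul_of_pos_right h hpos
    _ ≤ _ := mul_le_mul_of_nonneg_left h2 (sq_nonneg _)

theorem hellingerSq_nonneg {q : ℕ} (f g : PMF (Fin q)) : 0 ≤ hellingerSq f g := by
  unfold hellingerSq
  positivity

theorem hellingerSq_le_one {q : ℕ} (f g : PMF (Fin q)) : hellingerSq f g ≤ 1 := by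
  have : ∑ i, (√(f i).toReal - √(g i).toReal) ^ 2 ≤ ∑ i, ((f i).toReal + (g i).toReal) :=
    Finset.sum_le_sum fun i _ => by
      nlinarith [Real.sq_sqrt (ENNReal.toReal_nonneg (a := f i)),
        Real.sq_sqrt (ENNReal.toReal_nonneg (a := g i)),
        mul_nonneg (Real.sqrt_nonneg (f i).toReal) (Real.sqrt_nonneg (g i).toReal)]
  rw [Finset.sum_add_distrib, sum_toReal, sum_toReal] at this
  unfold hellingerSq
  linarith

theorem pos_of_pmf {q : ℕ} (f : PMF (Fin q)) : 0 < q := by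
  by_contra h
  obtain rfl : q = 0 := by omega
  simpa using sum_toReal f

theorem exists_symbol_hellingerSq_le {q : ℕ} (f g : PMF (Fin q)) :
    ∃ x, 2 * hellingerSq f g ≤ q * (√(f x).toReal - √(g x).toReal) ^ 2 := by
  have : Nonempty (Fin q) := ⟨⟨0, pos_of_pmf f⟩⟩
  by_contra! h
  have := Finset.sum_lt_sum_of_nonempty (Finset.univ_nonempty (α := Fin q)) fun x _ => h x
  rw [← Finset.mul_sum, Finset.sum_const, Finset.card_univ, Fintype.card_fin, nsmul_eq_mul] at this
  unfold hellingerSq at this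
  linarith

/-- The counted set gains `u` itself and loses at most `r`. -/
theorem rank_le_card_core {n k : ℕ} (c : Fin n → Fin k) (u r : Fin n) :
    rank (oracle c) u u ≤ (core c u r).card := by
  have h1 : (core c u r) = (Finset.univ.filter fun a => a ≤ u ∧ c a = c u).erase r := by
    ext a
    simp only [core, Finset.mem_filter, Finset.mem_univ, true_and, Finset.mem_erase]
    tauto
  have h2 : rank (oracle c) u u + 1 = (Finset.univ.filter fun a => a ≤ u ∧ c a = c u).card := by
    have h3 := rank_succ (O := oracle c) (u : ℕ) (u : ℕ)
    rw [if_pos ((oracle_val c u u).2 rfl)] at h3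
    rw [← h3]
    refine (Finset.card_bij (fun (a : Fin n) _ => (a : ℕ)) (fun a ha => ?_)
      (fun a _ b _ h => Fin.ext h) fun a ha => ?_).symm
    · have := (Finset.mem_filter.1 ha).2
      exact Finset.mem_filter.2 ⟨Finset.mem_range.2 (Nat.lt_succ_of_le this.1),
        (oracle_val c a u).2 this.2⟩
    · have ha' := Finset.mem_filter.1 ha
      have hlt := Finset.mem_range.1 ha'.1
      refine ⟨⟨a, by omega⟩, Finset.mem_filter.2 ⟨Finset.mem_univ _, ?_,
        (oracle_val c ⟨a, by omega⟩ u).1 ha'.2⟩, rfl⟩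
      exact Fin.le_def.2 (Nat.le_of_lt_succ hlt)
  rw [h1]
  have := Finset.pred_card_le_card_erase
    (s := Finset.univ.filter fun a => a ≤ u ∧ c a = c u) (a := r)
  omega

theorem sideArray_lt {n q : ℕ} (hq : 0 < q) (W : Pair n → Fin q) (i : ℕ) : sideArray W i < q := by
  unfold sideArray
  split_ifs
  · exact Fin.is_lt _
  · exact hq

/-- With `ρ² = 5 L`, square roots of counts of two elements with the same law differ by at most
`2ρ`. Passing the test with `500` forces a gap above `7ρ`, so the tested element is outside, and
every outside element has a gap above `5ρ`. The threshold `40` lies between `2ρ` and `5ρ`. -/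
theorem separates_of_concentrated {n k q : ℕ} {c : Fin n → Fin k} {fp fm : PMF (Fin q)} {L M : ℕ}
    {W : Pair n → Fin q} (hW : Concentrated c fp fm √(5 * L) W) (hqn : q ≤ n) (hL : 0 < L)
    (hM : n ≤ M ∨ (∀ u, ∃ v, c v ≠ c u) ∧ 500 * q * L ≤ M * hellingerSq fp fm) :
    Separates n (sideArray W) (oracle c) L 500 40 M := by
  have hLpos : (0 : ℝ) < L := Nat.cast_pos.2 hL
  set ρ := √(5 * (L : ℝ)) with hρdef
  have hρ : 0 < ρ := Real.sqrt_pos.2 (by positivity)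
  have hρsq : ρ ^ 2 = 5 * L := Real.sq_sqrt (by positivity)
  have hmem : ∀ u r v : Fin n, ¬ ((v : ℕ) ≤ u ∧ oracle c v u = true ∧ (v : ℕ) ≠ r) →
      v ∉ core c u r := fun u r v h hv => h <| by
    have := (Finset.mem_filter.1 hv).2
    exact ⟨this.1, (oracle_val c v u).2 this.2.1, fun e => this.2.2 (Fin.ext e)⟩
  have hr : ∀ u r : Fin n, r ∉ core c u r := fun u r h => (Finset.mem_filter.1 h).2.2.2 rfl
  refine ⟨fun u hu r hr' hru x w hw hwA hfar v hv hvA => ?_, fun u hu r hr' hru hMu => ?_⟩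
  · have hru' : c ⟨r, hr'⟩ = c ⟨u, hu⟩ := (oracle_val c ⟨r, hr'⟩ ⟨u, hu⟩).1 hru
    have hov := oracle_val c ⟨v, hv⟩ ⟨u, hu⟩
    simp only at hov
    -- For numbers that are not symbols all counts vanish, and the strict inequality in `Far` fails.
    have hx : x < q := by
      by_contra hx
      have hzero : ∀ v, clusterCount n (sideArray W) (oracle c) u r x v = 0 := fun v => by
        rw [clusterCount, Finset.card_eq_zero, Finset.filter_eq_empty_iff]
        rintro a - ⟨-, -, -, h⟩
        exact hx (h ▸ sideArray_lt (pos_of_pmf fp) W _)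
      simp [hzero, Far] at hfar
    have hN := fun (v : Fin n) hv => hW ⟨u, hu⟩ ⟨r, hr'⟩ v hv ⟨x, hx⟩
    have h0 := hN ⟨r, hr'⟩ (hr _ _)
    have h1 := hN ⟨w, hw⟩ (hmem _ _ _ hwA)
    have h2 := hN ⟨v, hv⟩ (hmem _ _ _ hvA)
    simp only at h0 h1 h2
    rw [if_pos hru'] at h0
    rw [hov]
    have hfar' := hfar.lt_sq
    push_cast at hfar'
    -- The squared gap exceeds `250 L = 50 ρ²`, and `49 < 50`.
    have h7 : 7 * ρ < |√(clusterCount n (sideArray W) (oracle c) u r x w : ℝ) -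
        √(clusterCount n (sideArray W) (oracle c) u r x r)| := by
      by_contra hle
      have := pow_le_pow_left₀ (abs_nonneg _) (not_lt.1 hle) 2
      rw [sq_abs] at this
      nlinarith
    rw [abs_le] at h0 h1 h2
    have hcw : c ⟨w, hw⟩ ≠ c ⟨u, hu⟩ := fun hcw => by
      rw [if_pos hcw] at h1
      rcases lt_abs.1 h7 with h | h <;> linarith [h0.1, h0.2, h1.1, h1.2]
    rw [if_neg hcw] at h1
    by_cases hcv : c ⟨v, hv⟩ = c ⟨u, hu⟩
    · rw [if_pos hcv] at h2
      refine iff_of_true (fun hfar => ?_) hcv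
      -- This would give `40 L < 2 (2ρ)² = 40 L`.
      have := hfar.lt_sq
      push_cast at this
      nlinarith [h0.1, h0.2, h2.1, h2.2]
    · rw [if_neg hcv] at h2
      refine iff_of_false (not_not.2 (far_of_lt_sq ?_)) hcv
      push_cast
      -- `v` and `w` share the same centre, so the gap of `v` is above `5ρ`, and `25 ρ² = 125 L ≥ 40
      -- L`.
      rcases lt_abs.1 h7 with h | h <;> nlinarith [h0.1, h0.2, h1.1, h1.2, h2.1, h2.2]
  · have hru' : c ⟨r, hr'⟩ = c ⟨u, hu⟩ := (oracle_val c ⟨r, hr'⟩ ⟨u, hu⟩).1 hru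
    rcases hM with hM | ⟨hne, hM⟩
    · have : rank (oracle c) u u ≤ u := (Finset.card_filter_le _ _).trans (Finset.card_range u).le
      omega
    obtain ⟨v, hv⟩ := hne ⟨u, hu⟩
    obtain ⟨x, hx⟩ := exists_symbol_hellingerSq_le fp fm
    refine ⟨v, v.2, ?_, x, x.2.trans_le hqn, far_of_lt_sq ?_⟩
    · rw [← Bool.not_eq_true]
      exact fun h => hv ((oracle_val c v ⟨u, hu⟩).1 h)
    have h0 := hW ⟨u, hu⟩ ⟨r, hr'⟩ ⟨r, hr'⟩ (hr _ _) x
    have h1 := hW ⟨u, hu⟩ ⟨r, hr'⟩ v (fun h => hv (Finset.mem_filter.1 h).2.2.1) x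
    simp only at h0 h1
    rw [if_pos hru', Real.sqrt_mul (Nat.cast_nonneg _), abs_le] at h0
    rw [if_neg hv, Real.sqrt_mul (Nat.cast_nonneg _), abs_le] at h1
    have hcard : (M : ℝ) ≤ (core c ⟨u, hu⟩ ⟨r, hr'⟩).card := by
      exact_mod_cast hMu.trans (rank_le_card_core c ⟨u, hu⟩ ⟨r, hr'⟩)
    set s : ℝ := ((core c ⟨u, hu⟩ ⟨r, hr'⟩).card : ℝ) with hs
    have hsq : √s ^ 2 = s := Real.sq_sqrt (Nat.cast_nonneg _)
    have hqpos : (0 : ℝ) < q := Nat.cast_pos.2 (pos_of_pmf fp)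
    have hgap : 1000 * (L : ℝ) ≤ (√s * √(fp x).toReal - √s * √(fm x).toReal) ^ 2 := by
      rw [← mul_sub, mul_pow, hsq]
      have h3 : (M : ℝ) * hellingerSq fp fm ≤ s * hellingerSq fp fm :=
        mul_le_mul_of_nonneg_right hcard (hellingerSq_nonneg _ _)
      have h4 := mul_le_mul_of_nonneg_left hx (Nat.cast_nonneg (α := ℝ)
        (core c ⟨u, hu⟩ ⟨r, hr'⟩).card)
      rw [← hs] at h4
      refine le_of_mul_le_mul_left ?_ hqpos
      nlinarith
    -- `1000 L = 200 ρ² > 144 ρ²`. Two deviations by `ρ` leave a gap above `10ρ`, and `100 ρ² = 500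
    -- L` is the threshold of the test.
    have hgap' : 12 * ρ < |√s * √(fp x).toReal - √s * √(fm x).toReal| := by
      by_contra hle
      have := pow_le_pow_left₀ (abs_nonneg _) (not_lt.1 hle) 2
      rw [sq_abs] at this
      nlinarith
    push_cast
    rcases lt_abs.1 hgap' with h | h <;> nlinarith [h0.1, h0.2, h1.1, h1.2]

/-- Within a cluster the rank is strictly increasing, so an element is determined by its cluster and
its rank, and the ranks allowed are `0, …, M`. -/
theorem earlyCount_le {n k : ℕ} (c : Fin n → Fin k) (M : ℕ) :
    earlyCount (oracle c) M n ≤ n ∧ earlyCount (oracle c) M n ≤ k * (M + 1) := by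
  refine ⟨(Finset.card_filter_le _ _).trans (Finset.card_range n).le, ?_⟩
  by_cases hn : n = 0
  · simp [hn, earlyCount]
  have : NeZero n := ⟨hn⟩
  have hcard : ((Finset.univ : Finset (Fin k)) ×ˢ Finset.range (M + 1)).card = k * (M + 1) := by
    simp
  rw [← hcard]
  refine Finset.card_le_card_of_injOn
    (fun a => (c (Fin.ofNat n a), rank (oracle c) a a)) (fun a ha => ?_) ?_
  · have := (Finset.mem_filter.1 ha).2
    simpa using Nat.lt_succ_of_le this
  · have key : ∀ a < n, ∀ b < n, a < b → c (Fin.ofNat n a) = c (Fin.ofNat n b) →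
        rank (oracle c) a a < rank (oracle c) b b := by
      intro a ha b hb hab e
      have hO : oracle c a b = true := by
        have := (oracle_val c (Fin.ofNat n a) (Fin.ofNat n b)).2 e
        simpa [Fin.ofNat, Nat.mod_eq_of_lt ha, Nat.mod_eq_of_lt hb] using this
      rw [(isEquivalenceOracle_oracle c).rank_congr hO]
      refine lt_of_lt_of_le (b := rank (oracle c) (a + 1) b) ?_ ?_
      · rw [rank_succ, if_pos hO]
        exact Nat.lt_succ_self _
      · exact Finset.card_le_card (Finset.filter_subset_filter _ (Finset.range_mono hab))
    intro a ha b hb e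
    simp only [Finset.coe_filter, Set.mem_ofPred_eq, Finset.mem_range, Prod.mk.injEq] at ha hb e
    rcases lt_trichotomy a b with h | h | h
    · exact absurd e.2 (key a ha.1 b hb.1 h e.1).ne
    · exact h
    · exact absurd e.2 (key b hb.1 a ha.1 h e.1.symm).ne'

/-! ### Correctness of the whole run -/

theorem not_writes_logCmd {a : ℕ} (ha : a < 11) : ¬ logCmd.Writes a := by
  simp [logCmd, Cmd.Writes]
  omega

theorem Consistent.recovers {n k : ℕ} {c : Fin n → Fin k} {t : State}
    (h : Consistent (oracle c) n (t.mem 2)) (h' : ∀ v < n, t.mem 2 v ≠ 0) : Recovers t c :=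
  fun u v => (h.label_eq_iff (isEquivalenceOracle_oracle c) u.2 v.2 (h' u u.2) (h' v v.2)).trans
    (oracle_val c u v)

/-- The program with confirmation by queries is always correct. -/
theorem recovers_of_confirm (T₁ T₂ : ℕ) {n k q : ℕ} (c : Fin n → Fin k) (W : Pair n → Fin q)
    (ω : ℕ → Bool) :
    ∃ t, HaltsIn (mainCmd true T₁ T₂).toProg c W ω t ∧ Recovers t c := by
  obtain ⟨t, ht, hrun⟩ := Cmd.haltsIn (ok_mainCmd true T₁ T₂) c W ω
  refine ⟨t, ht, ?_⟩
  have hmem : t.mem = _ := congrArg Prod.fst hrun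
  have key := consistent_of_confirm (isEquivalenceOracle_oracle c) T₁ T₂
    (s := logCmd.run (oracle c) ((initState W).mem, 0))
    (by rw [Cmd.run_of_not_writes _ (not_writes_logCmd (by norm_num))]; simp [initState])
    (fun v => by rw [Cmd.run_of_not_writes _ (not_writes_logCmd (by norm_num))]; simp [initState])
  refine Consistent.recovers ?_ ?_ <;> rw [hmem]
  · exact key.1
  · exact key.2

theorem size_eq_of_pow {n L : ℕ} (h1 : n < 2 ^ L) (h2 : 2 ^ L ≤ 2 * n) : L = n.size := by
  refine le_antisymm ?_ (Nat.size_le.2 h1)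
  rcases L with _ | L
  · exact Nat.zero_le _
  · exact Nat.lt_size.2 (by rw [pow_succ] at h2; omega)

theorem haltsIn_of_separates {T₁ T₂ M : ℕ} {n k q : ℕ} {c : Fin n → Fin k} {W : Pair n → Fin q}
    (hn : 0 < n) (hW : Separates n (sideArray W) (oracle c) n.size T₁ T₂ M) (conf : Bool)
    (ω : ℕ → Bool) :
    ∃ t, HaltsIn (mainCmd conf T₁ T₂).toProg c W ω t ∧ Recovers t c ∧
      t.queries ≤ k * earlyCount (oracle c) M n + if conf = true then n else 0 := by
  obtain ⟨t, ht, hrun⟩ := Cmd.haltsIn (ok_mainCmd conf T₁ T₂) c W ω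
  refine ⟨t, ht, ?_⟩
  have hmem : t.mem = _ := congrArg Prod.fst hrun
  have hq : t.queries = _ := congrArg Prod.snd hrun
  obtain ⟨hL1, hL2, hL3⟩ := run_logCmd (oracle c) (s := ((initState W).mem, 0)) (n := n)
    (by simp [initState]) hn (by simp [initState])
  have key := run_stages_of_separates hW (isEquivalenceOracle_oracle c) conf
    (fun _ h => repCount_le c h)
    (s := logCmd.run (oracle c) ((initState W).mem, 0))
    (by rw [Cmd.run_of_not_writes _ (not_writes_logCmd (by norm_num))]; simp [initState])
    (by
      rw [Cmd.run_of_not_writes _ (not_writes_logCmd (by norm_num))]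
      funext i
      simp [initState])
    (size_eq_of_pow hL1 hL2)
    (fun v => by rw [Cmd.run_of_not_writes _ (not_writes_logCmd (by norm_num))]; simp [initState])
    hL3
  refine ⟨Consistent.recovers ?_ ?_, ?_⟩
  · rw [hmem]; exact key.1.1
  · rw [hmem]; exact key.1.2
  · rw [hq]; exact key.2

/-! ### Failure probability -/

/-- The failure probability. -/
noncomputable def failureBound (q n : ℕ) : ℝ := if n < q + 3 then 1 else 2 * q / n ^ 2

theorem isLittleO_failureBound (q : ℕ) :
    Asymptotics.IsLittleO Filter.atTop (failureBound q) (fun n : ℕ => 1 / (n : ℝ)) := by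
  have heq : (fun n : ℕ => (2 * q : ℝ) * (1 / (n : ℝ) * (1 / n))) =ᶠ[Filter.atTop]
      failureBound q := by
    filter_upwards [Filter.eventually_ge_atTop (q + 3)] with n hn
    rw [failureBound, if_neg (by omega)]
    field_simp
  refine Asymptotics.IsLittleO.congr' ?_ heq (Filter.EventuallyEq.refl _ _)
  refine Asymptotics.IsLittleO.const_mul_left ?_ _
  have h1 : Asymptotics.IsLittleO Filter.atTop (fun n : ℕ => 1 / (n : ℝ)) (fun _ => (1 : ℝ)) :=
    (Asymptotics.isLittleO_one_iff ℝ).2 tendsto_one_div_atTop_nhds_zero_nat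
  simpa using (Asymptotics.isBigO_refl (fun n : ℕ => 1 / (n : ℝ)) Filter.atTop).mul_isLittleO h1

instance : IsProbabilityMeasure coinLaw := by
  unfold coinLaw
  infer_instance

instance {n k q : ℕ} (c : Fin n → Fin k) (fp fm : PMF (Fin q)) :
    IsProbabilityMeasure (jointLaw c fp fm) := by
  unfold jointLaw
  infer_instance

/-- An event whose complement forces the counts to deviate has probability `1 - o(1 / n)`. -/
theorem jointLaw_le_failureBound {n k q : ℕ} (c : Fin n → Fin k) (fp fm : PMF (Fin q))
    {E : Set ((Pair n → Fin q) × (ℕ → Bool))}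
    (hE : q + 3 ≤ n → ∀ x ∈ E, ¬ Concentrated c fp fm √(5 * n.size) x.1) :
    (jointLaw c fp fm).real E ≤ failureBound q n := by
  unfold failureBound
  split_ifs with hn
  · exact measureReal_le_one
  · have hsub : E ⊆ {W | ¬ Concentrated c fp fm √(5 * n.size) W} ×ˢ Set.univ :=
      fun x hx => ⟨hE (by omega) x hx, Set.mem_univ _⟩
    refine (measureReal_mono hsub).trans ?_
    rw [jointLaw, measureReal_prod_prod, probReal_univ, mul_one]
    refine (measure_not_concentrated c fp fm (Real.sqrt_nonneg _)).trans ?_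
    rw [Real.sq_sqrt (by positivity), Real.exp_neg, ← div_eq_mul_inv]
    have hnpos : (0 : ℝ) < n := Nat.cast_pos.2 (by omega)
    -- From `n ≤ 2 ^ n.size ≤ e ^ n.size`. The factor `n ^ 3` of the union bound thus leaves `n ^
    -- (-2)`, which is `o(1 / n)`; this fixes the constant `5` in `ρ² = 5 L`.
    have hexp : (n : ℝ) ^ 5 ≤ Real.exp (5 * n.size) := by
      have h1 : (n : ℝ) ≤ 2 ^ n.size := by exact_mod_cast (Nat.lt_size_self n).le
      have h2 : (2 : ℝ) ≤ Real.exp 1 := by linarith [Real.add_one_le_exp (1 : ℝ)]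
      have h3 : (n : ℝ) ≤ Real.exp n.size := by
        refine h1.trans ((pow_le_pow_left₀ zero_le_two h2 _).trans (le_of_eq ?_))
        rw [← Real.exp_nat_mul, mul_one]
      refine (pow_le_pow_left₀ hnpos.le h3 5).trans (le_of_eq ?_)
      rw [← Real.exp_nat_mul]
      norm_num
    rw [div_le_div_iff₀ (Real.exp_pos _) (by positivity)]
    calc 2 * (q : ℝ) * n ^ 3 * n ^ 2 = 2 * q * n ^ 5 := by ring
      _ ≤ 2 * q * Real.exp (5 * n.size) := by gcongr

/-! ### The query bounds -/

theorem size_le_log {n : ℕ} (hn : 3 ≤ n) : (n.size : ℝ) ≤ 4 * Real.log n := by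
  have h1 : 2 ^ n.size ≤ 2 * n := by
    have h : n.size - 1 < n.size := Nat.sub_lt (Nat.size_pos.2 (by omega)) one_pos
    have := Nat.lt_size.1 h
    obtain ⟨m, hm⟩ : ∃ m, n.size = m + 1 := ⟨n.size - 1, by omega⟩
    rw [hm, Nat.add_sub_cancel] at this
    rw [hm, pow_succ]
    omega
  have h2 : (2 : ℝ) ^ n.size ≤ n ^ 2 := by
    have h3 : 2 ^ n.size ≤ n ^ 2 := h1.trans (by nlinarith)
    exact_mod_cast h3
  have h3 := Real.log_le_log (by positivity) h2
  rw [Real.log_pow, Real.log_pow] at h3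
  have h4 : (1 / 2 : ℝ) ≤ Real.log 2 := by linarith [Real.log_two_gt_d9]
  have h5 : (n.size : ℝ) * (1 / 2) ≤ n.size * Real.log 2 :=
    mul_le_mul_of_nonneg_left h4 (Nat.cast_nonneg _)
  push_cast at h3
  linarith

theorem one_le_log {n : ℕ} (hn : 3 ≤ n) : 1 ≤ Real.log n := by
  rw [Real.le_log_iff_exp_le (by positivity)]
  have : (3 : ℝ) ≤ n := by exact_mod_cast hn
  linarith [Real.exp_one_lt_d9]

/-- If there are at least two clusters, then the number of queries is bounded as claimed. -/
theorem haltsIn_of_concentrated {n k q : ℕ} {c : Fin n → Fin k} {fp fm : PMF (Fin q)}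
    (hn : q + 3 ≤ n) (hc : ∀ u, ∃ v, c v ≠ c u) {W : Pair n → Fin q}
    (hW : Concentrated c fp fm √(5 * n.size) W) (conf : Bool) (ω : ℕ → Bool) :
    ∃ t, HaltsIn (mainCmd conf 500 40).toProg c W ω t ∧ Recovers t c ∧
      (t.queries : ℝ) ≤ (2000 * q + 8) * queryBound n k (hellingerSq fp fm) +
        if conf = true then (n : ℝ) else 0 := by
  have hsize : 0 < n.size := Nat.size_pos.2 (by omega)
  have hsize' : (1 : ℝ) ≤ n.size := by exact_mod_cast hsize
  set h := hellingerSq fp fm with hh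
  have h0 : 0 ≤ h := hellingerSq_nonneg fp fm
  have h1 : h ≤ 1 := hellingerSq_le_one fp fm
  have hq0 : (0 : ℝ) ≤ q := Nat.cast_nonneg q
  rcases h0.eq_or_lt with hz | hpos
  -- With `M = n` the condition `Separates.ready` is void, as ranks stay below `n`: the side
  -- information is useless, and `n k` queries suffice.
  · obtain ⟨t, ht, hr, hq⟩ := haltsIn_of_separates (by omega)
      (separates_of_concentrated hW (by omega) hsize (Or.inl le_rfl)) conf ω
    refine ⟨t, ht, hr, ?_⟩
    have h2 : t.queries ≤ k * n + if conf = true then n else 0 :=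
      hq.trans (Nat.add_le_add_right (Nat.mul_le_mul_left _ (earlyCount_le c n).1) _)
    have h3 : (t.queries : ℝ) ≤ k * n + if conf = true then (n : ℝ) else 0 := by exact_mod_cast h2
    rw [queryBound, if_pos hz.symm]
    refine h3.trans (add_le_add_left ?_ _)
    have : (0 : ℝ) ≤ n * k := by positivity
    nlinarith
  · set M := ⌈500 * q * n.size / h⌉₊ with hM
    have hM1 : 500 * q * n.size / h ≤ M := Nat.le_ceil _
    have hM2 : (M : ℝ) < 500 * q * n.size / h + 1 := Nat.ceil_lt_add_one (by positivity)
    obtain ⟨t, ht, hr, hq⟩ := haltsIn_of_separates (by omega)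
      (separates_of_concentrated hW (by omega) hsize
        (Or.inr ⟨hc, (div_le_iff₀ hpos).1 hM1⟩)) conf ω
    refine ⟨t, ht, hr, ?_⟩
    have h2 : (t.queries : ℝ) ≤ k * earlyCount (oracle c) M n +
        if conf = true then (n : ℝ) else 0 := by
      exact_mod_cast hq
    have h3 : (earlyCount (oracle c) M n : ℝ) ≤ n := by exact_mod_cast (earlyCount_le c M).1
    have h4 : (earlyCount (oracle c) M n : ℝ) ≤ k * (M + 1) := by
      exact_mod_cast (earlyCount_le c M).2
    have hk0 : (0 : ℝ) ≤ k := Nat.cast_nonneg k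
    rw [queryBound, if_neg hpos.ne']
    refine h2.trans (add_le_add_left ?_ _)
    rw [mul_min_of_nonneg _ _ (by positivity), le_min_iff]
    constructor
    · have h5 := mul_le_mul_of_nonneg_left h3 hk0
      have : (0 : ℝ) ≤ n * k := by positivity
      nlinarith
    -- `(M + 1) h < 500 q L + 2 h ≤ (500 q + 2) L`, because `h ≤ 1 ≤ L`, and `L ≤ 4 log n`.
    · have hM3 : (M : ℝ) + 1 ≤ (2000 * q + 8) * Real.log n / h := by
        rw [le_div_iff₀ hpos]
        have h6 : (M : ℝ) * h < 500 * q * n.size + h := by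
          have := mul_lt_mul_of_pos_right hM2 hpos
          rwa [add_mul, one_mul, div_mul_cancel₀ _ hpos.ne'] at this
        have h7 := mul_le_mul_of_nonneg_left (size_le_log (n := n) (by omega))
          (show (0 : ℝ) ≤ 500 * q + 2 by positivity)
        nlinarith
      calc (k : ℝ) * earlyCount (oracle c) M n ≤ k * (k * (M + 1)) := by gcongr
        _ ≤ k * (k * ((2000 * q + 8) * Real.log n / h)) := by gcongr
        _ = _ := by ring

theorem queryBound_nonneg (n k : ℕ) {h : ℝ} (hh : 0 ≤ h) : 0 ≤ queryBound n k h := by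
  unfold queryBound
  have := Real.log_natCast_nonneg n
  split_ifs
  · positivity
  · exact le_min (by positivity) (by positivity)

/-- With confirmation by queries, the number of queries is bounded as claimed. -/
theorem haltsIn_confirm_of_concentrated {n k q : ℕ} {c : Fin n → Fin k} {fp fm : PMF (Fin q)}
    (hn : q + 3 ≤ n) (hc : Function.Surjective c) {W : Pair n → Fin q}
    (hW : Concentrated c fp fm √(5 * n.size) W) (ω : ℕ → Bool) :
    ∃ t, HaltsIn (mainCmd true 500 40).toProg c W ω t ∧
      (t.queries : ℝ) ≤ (2000 * q + 8) *
        (n * Real.log n + queryBound n k (hellingerSq fp fm)) := by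
  have hB := queryBound_nonneg n k (hellingerSq_nonneg fp fm)
  have hq0 : (0 : ℝ) ≤ q := Nat.cast_nonneg q
  have hlog : (n : ℝ) ≤ n * Real.log n :=
    le_mul_of_one_le_right (Nat.cast_nonneg n) (one_le_log (by omega))
  have hn0 : (0 : ℝ) ≤ n := Nat.cast_nonneg n
  by_cases h2 : ∀ u, ∃ v, c v ≠ c u
  · obtain ⟨t, ht, -, hq⟩ := haltsIn_of_concentrated hn h2 hW true ω
    refine ⟨t, ht, hq.trans ?_⟩
    rw [if_pos rfl]
    nlinarith
  · push Not at h2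
    obtain ⟨u, hu⟩ := h2
    have hk : k ≤ 1 := by
      have : Subsingleton (Fin k) := ⟨fun i j => by
        obtain ⟨a, rfl⟩ := hc i
        obtain ⟨b, rfl⟩ := hc j
        rw [hu a, hu b]⟩
      simpa using Fintype.card_le_one_iff_subsingleton.2 this
    -- With a single cluster there is no outside element to compare with, so `M = n` is used: at
    -- most `n` search queries and `n` confirmations, which the term `n log n` absorbs.
    obtain ⟨t, ht, -, hq⟩ := haltsIn_of_separates (by omega)
      (separates_of_concentrated hW (by omega) (Nat.size_pos.2 (by omega)) (Or.inl le_rfl)) true ω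
    refine ⟨t, ht, ?_⟩
    have h3 : t.queries ≤ 1 * n + n :=
      hq.trans (Nat.add_le_add (Nat.mul_le_mul hk (earlyCount_le c n).1) (by simp))
    have h4 : (t.queries : ℝ) ≤ 1 * n + n := by exact_mod_cast h3
    nlinarith

/-- The bound on the cluster sizes enters only by excluding a single cluster, so neither the program
nor the constants depend on `ε`. -/
theorem exists_ne_of_card_le {n k : ℕ} {c : Fin n → Fin k} {ε : ℝ} (hε : 0 < ε)
    (hc : ∀ i, ((Finset.univ.filter fun v => c v = i).card : ℝ) ≤ (1 - ε) * n) (u : Fin n) :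
    ∃ v, c v ≠ c u := by
  by_contra! h
  have h1 := hc (c u)
  rw [Finset.filter_true_of_mem fun v _ => h v, Finset.card_univ, Fintype.card_fin] at h1
  have : (0 : ℝ) < n := Nat.cast_pos.2 u.pos
  nlinarith

end QueryCluster

theorem theorem1 (q : ℕ) :
    -- Monte Carlo algorithm, for clusters that contain at most a fraction `1 - ε` of the elements
    (∀ ε : ℝ, 0 < ε →
      ∃ P : QueryCluster.Prog, QueryCluster.PolyTime q P ∧
        ∃ (C : ℝ) (δ : ℕ → ℝ), Asymptotics.IsLittleO Filter.atTop δ (fun n : ℕ => 1 / (n : ℝ)) ∧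
          ∀ (n k : ℕ) (c : Fin n → Fin k) (fp fm : PMF (Fin q)), Function.Surjective c →
            (∀ i : Fin k, ((Finset.univ.filter fun v => c v = i).card : ℝ) ≤ (1 - ε) * n) →
            (QueryCluster.jointLaw c fp fm).real
              {x | ¬ ∃ t, QueryCluster.HaltsIn P c x.1 x.2 t ∧ QueryCluster.Recovers t c ∧
                (t.queries : ℝ) ≤
                  C * QueryCluster.queryBound n k (QueryCluster.hellingerSq fp fm)} ≤ δ n) ∧
    -- Las Vegas algorithm
    (∃ P : QueryCluster.Prog, QueryCluster.PolyTime q P ∧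
      (∀ (n k : ℕ) (c : Fin n → Fin k) (W : QueryCluster.Pair n → Fin q) (ω : ℕ → Bool),
        ∃ t, QueryCluster.HaltsIn P c W ω t ∧ QueryCluster.Recovers t c) ∧
      ∃ (C : ℝ) (δ : ℕ → ℝ), Asymptotics.IsLittleO Filter.atTop δ (fun n : ℕ => 1 / (n : ℝ)) ∧
        ∀ (n k : ℕ) (c : Fin n → Fin k) (fp fm : PMF (Fin q)), Function.Surjective c →
          (QueryCluster.jointLaw c fp fm).real
            {x | ¬ ∃ t, QueryCluster.HaltsIn P c x.1 x.2 t ∧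
              (t.queries : ℝ) ≤
                C * (n * Real.log n +
                  QueryCluster.queryBound n k (QueryCluster.hellingerSq fp fm))} ≤ δ n) := by
  open QueryCluster in
  refine ⟨fun ε hε => ⟨(mainCmd false 500 40).toProg, Cmd.polyTime (ok_mainCmd _ _ _) q,
    2000 * q + 8, failureBound q, isLittleO_failureBound q, fun n k c fp fm _ hcard => ?_⟩,
    (mainCmd true 500 40).toProg, Cmd.polyTime (ok_mainCmd _ _ _) q,
    fun n k c W ω => recovers_of_confirm 500 40 c W ω,
    2000 * q + 8, failureBound q, isLittleO_failureBound q, fun n k c fp fm hc => ?_⟩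
  · refine jointLaw_le_failureBound c fp fm fun hn x hx hW => hx ?_
    obtain ⟨t, ht, hr, hq⟩ :=
      haltsIn_of_concentrated hn (exists_ne_of_card_le hε hcard) hW false x.2
    exact ⟨t, ht, hr, by simpa using hq⟩
  · exact jointLaw_le_failureBound c fp fm fun hn x hx hW =>
      hx (haltsIn_confirm_of_concentrated hn hc hW x.2)
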